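/- Let $\mathbb D=\{z\in\mathbb C:|z|<1\}$ and let $\mathcal A$ be the class of functions $f$ analytic in $\mathbb D$ with $f(0)=f'(0)-1=0$. For $\alpha\ge 0$, $\gamma\ge0$ and $\beta<1$ let $W_\beta(\alpha,\gamma)$ be the class of all $f\in\mathcal A$ for which there is $\phi\in\mathbb R$ with $$\mathrm{Re}\left(e^{i\phi}\left((1-\alpha+2\gamma)\frac{f(z)}{z}+(\alpha-2\gamma)f'(z)+\gamma zf''(z)-\beta\right)\right)>0\qquad(z\in\mathbb D),$$ where $f(z)/z$ is given its limit value $1$ at $z=0$. For $0\le\xi\le1$ let the Pascu class $M(\xi)$ be the class of all $F\in\mathcal A$ such that $\xi zF'(z)+(1-\xi)F(z)\ne0$ and $$\mathrm{Re}\,\frac{\xi z(zF'(z))'+(1-\xi)zF'(z)}{\xi zF'(z)+(1-\xi)F(z)}>0\qquad(0<|z|<1).$$ **Theorem.** Let $\gamma>0$, and let $\mu\ge1$ and $\nu$ be real numbers with $\mu+\nu=\alpha-\gamma$ and $\mu\nu=\gamma$. Let $0\le\xi\le1$, $-1<c<0$ and $p>2$. Let $q$ be the solution on $(0,1)$ of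 $$\frac{d}{dt}\left(t^{1/\nu}q(t)\right)=\frac{1}{\mu\nu}\,t^{1/\nu-1}\int_0^1 s^{1/\mu-1}\,\frac{1-st}{(1+st)^3}\,ds,\qquad \lim_{t\to0^+}q(t)=1,$$ and let $\beta<1$ be given by $$\frac{\beta-\frac12}{1-\beta}=-\frac{(1+c)^p}{\Gamma(p)}\int_0^1 t^{c}\left(\log\frac1t\right)^{p-1}q(t)\,dt .$$ Then for every $f\in W_\beta(\alpha,\gamma)$ the function $$F(z)=\frac{(c+1)^p}{\Gamma(p)}\int_0^1\left(\log\frac1t\right)^{p-1}t^{c-1}f(tz)\,dt\qquad(z\in\mathbb D)$$ belongs to $M(\xi)$. -/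

import Mathlib

open Filter Topology

noncomputable section

namespace KomatuPascu

/-- The class `𝒜` of functions analytic in the open unit disc, normalized by
`f(0) = f'(0) - 1 = 0`. Values outside the disc play no role. -/
def ClassA (f : ℂ → ℂ) : Prop :=
  AnalyticOnNhd ℂ f (Metric.ball 0 1) ∧ f 0 = 0 ∧ deriv f 0 = 1

/-- The class `W_β(α, γ)`. Since `f 0 = 0`, the function `dslope f 0` is `f(z)/z` for `z ≠ 0`,
continued by its limit `f'(0)` at `z = 0`. -/
def ClassW (α β γ : ℝ) (f : ℂ → ℂ) : Prop :=
  ClassA f ∧ ∃ φ : ℝ, ∀ z ∈ Metric.ball (0 : ℂ) 1,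
    0 < (Complex.exp (φ * Complex.I) *
      ((1 - α + 2 * γ) * dslope f 0 z + (α - 2 * γ) * deriv f z
        + γ * z * deriv (deriv f) z - β)).re

/-- The Pascu class `M(ξ)`. The quotient has a removable singularity at `0` (with value `1`), so the
condition is imposed for `0 < |z| < 1`. Where the denominator vanishes the Lean quotient is `0`, so
the condition includes that the denominator has no zero in the punctured disc. -/
def ClassM (ξ : ℝ) (f : ℂ → ℂ) : Prop :=
  ClassA f ∧ ∀ z ∈ Metric.ball (0 : ℂ) 1, z ≠ 0 →
    0 < ((ξ * z * deriv (fun w => w * deriv f w) z + (1 - ξ) * (z * deriv f z)) /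
      (ξ * (z * deriv f z) + (1 - ξ) * f z)).re

/-- `q` solves, on `(0, 1)`, the differential equation
`d/dt (t^{1/ν} q(t)) = (1/(μν)) t^{1/ν-1} ∫₀¹ s^{1/μ-1} (1 - s t)/(1 + s t)³ ds`
with initial value `q(0⁺) = 1`. -/
def SolvesQ (μ ν : ℝ) (q : ℝ → ℝ) : Prop :=
  Tendsto q (𝓝[>] 0) (𝓝 1) ∧
  ∀ t ∈ Set.Ioo (0 : ℝ) 1,
    HasDerivAt (fun x : ℝ => x ^ (1 / ν) * q x)
      (1 / (μ * ν) * t ^ (1 / ν - 1) *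
        ∫ s in (0 : ℝ)..1, s ^ (1 / μ - 1) * ((1 - s * t) / (1 + s * t) ^ 3)) t

/-- The Komatu operator
`f ↦ ((c+1)^p / Γ(p)) ∫₀¹ (log (1/t))^{p-1} t^{c-1} f(tz) dt`. -/
def komatu (c p : ℝ) (f : ℂ → ℂ) (z : ℂ) : ℂ :=
  (((c + 1) ^ p / Real.Gamma p : ℝ) : ℂ) *
    ∫ t in (0 : ℝ)..1, ((Real.log (1 / t) ^ (p - 1) * t ^ (c - 1) : ℝ) : ℂ) * f (t * z)

end KomatuPascu

end

/-! Write `f(z) = z ∑ a_k z^k`. Every operation in sight then multiplies coefficients. The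
expression defining `W_β(α, γ)` has multiplier `1 + (α - γ)k + γk² = (1 + μk)(1 + νk)`, the Komatu
operator has multiplier `((c+1)/(k+c+1))^p`, and membership of `F` in `M(ξ)` says that `z ∑ (1 + ξk)
b_k z^k` is starlike, where `F(z) = z ∑ b_k z^k`. Starlikeness follows once `∑ (1 + (1+v)k/2)(1 +
ξk) b_k z^k` has no zero in the disc for any `|v| = 1` (`starlike_of_pser_ne_zero`).

Up to the constant `1 - β`, that series is the Hadamard product of `U`, the `W_β` expression, with a
kernel `G`, `G(0) = 1`. Such a product is a mean of `U` over a circle with weight `2 Re G - 1`. If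
`Re G ≥ 1/2`, the weight is nonnegative, so the mean stays in the open half-plane containing the
values of `U` and cannot vanish (`re_pser_mul_pos`).

The choice of `β` turns `Re G ≥ 1/2` into a lower bound for the real part of an explicit series by
the integral of `q`. Here `q(t) = ∑ (k+1)² (-t)^k / ((1+μk)(1+νk))` is decreasing, which reduces the
bound to a comparison of series at `z` and `-|z|` (`komatu_integral_le`, `le_re_pser`). Multipliers
such as `1/(k+A)^P` are averages over `s ↦ st` with positive weight and preserve nonnegativity on
`[0, 1]`. The conditions `μ ≥ 1`, `c < 0`, `p > 2` allow all factors but `1/(k+1)²` to be removed in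
this way. What remains is one inequality for an integral against `log (1/t)`
(`tsum_gapCoeff_nonneg`), proved by bounding the integrand below by the derivative of a function
vanishing at both endpoints. -/

namespace KomatuPascu

open MeasureTheory Set

/-! ### Power series converging in the unit disc -/

section PowerSeries

variable {𝕜 : Type*} [RCLike 𝕜]

/-- The sum of the power series with coefficients `a`. -/
noncomputable def pser (a : ℕ → 𝕜) (z : 𝕜) : 𝕜 := ∑' k, a k * z ^ k

/-- The power series with coefficients `a` converges absolutely in the open unit disc. -/
def UnitRadius (a : ℕ → 𝕜) : Prop :=
  ∀ r : ℝ, 0 ≤ r → r < 1 → Summable fun k => ‖a k‖ * r ^ k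

theorem UnitRadius.summable_norm {a : ℕ → 𝕜} (ha : UnitRadius a) {z : 𝕜} (hz : ‖z‖ < 1) :
    Summable fun k => ‖a k * z ^ k‖ := by
  simpa [norm_mul, norm_pow] using ha ‖z‖ (norm_nonneg z) hz

theorem UnitRadius.summable {a : ℕ → 𝕜} (ha : UnitRadius a) {z : 𝕜} (hz : ‖z‖ < 1) :
    Summable fun k => a k * z ^ k :=
  (ha.summable_norm hz).of_norm

theorem UnitRadius.hasSum {a : ℕ → 𝕜} (ha : UnitRadius a) {z : 𝕜} (hz : ‖z‖ < 1) :
    HasSum (fun k => a k * z ^ k) (pser a z) :=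
  (ha.summable hz).hasSum

theorem UnitRadius.of_norm_le {𝕜' : Type*} [RCLike 𝕜'] {a : ℕ → 𝕜} {b : ℕ → 𝕜'}
    (ha : UnitRadius a) {C : ℝ} (h : ∀ k, ‖b k‖ ≤ C * ‖a k‖) : UnitRadius b := by
  intro r h0 h1
  refine Summable.of_nonneg_of_le (fun k => by positivity) (fun k => ?_)
    ((ha r h0 h1).mul_left C)
  rw [← mul_assoc]
  exact mul_le_mul_of_nonneg_right (h k) (by positivity)

theorem UnitRadius.add {a b : ℕ → 𝕜} (ha : UnitRadius a) (hb : UnitRadius b) :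
    UnitRadius fun k => a k + b k := by
  intro r h0 h1
  refine Summable.of_nonneg_of_le (fun k => by positivity) (fun k => ?_)
    ((ha r h0 h1).add (hb r h0 h1))
  rw [← add_mul]
  exact mul_le_mul_of_nonneg_right (norm_add_le _ _) (by positivity)

theorem UnitRadius.const_mul {a : ℕ → 𝕜} (ha : UnitRadius a) (c : 𝕜) :
    UnitRadius fun k => c * a k :=
  ha.of_norm_le (C := ‖c‖) fun k => by rw [norm_mul]

theorem UnitRadius.one : UnitRadius fun _ : ℕ => (1 : 𝕜) := by
  intro r h0 h1
  simpa using summable_geometric_of_lt_one h0 h1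

theorem UnitRadius.single (c : 𝕜) : UnitRadius fun k : ℕ => if k = 0 then c else 0 :=
  UnitRadius.of_norm_le (UnitRadius.one (𝕜 := 𝕜)) (C := ‖c‖) fun k => by split_ifs <;> simp

/-- Passing to a slightly larger radius `ρ` absorbs the factor `k`, because `k (r/ρ)^k` is bounded.
-/
theorem UnitRadius.nat_mul {a : ℕ → 𝕜} (ha : UnitRadius a) :
    UnitRadius fun k => (k : 𝕜) * a k := by
  intro r h0 h1
  obtain ⟨ρ, hr, hρ⟩ := exists_between h1
  have hρ0 : 0 < ρ := h0.trans_lt hr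
  have ht := tendsto_self_mul_const_pow_of_lt_one (r := r / ρ) (by positivity)
    ((div_lt_one hρ0).2 hr)
  obtain ⟨C, hC⟩ := ht.bddAbove_range
  refine Summable.of_nonneg_of_le (fun k => by positivity) (fun k => ?_)
    ((ha ρ hρ0.le hρ).mul_left C)
  have h2 : (k : ℝ) * (r / ρ) ^ k ≤ C := hC ⟨k, rfl⟩
  have h3 : (k : ℝ) * r ^ k ≤ C * ρ ^ k := by
    rw [div_pow, ← mul_div_assoc, div_le_iff₀ (by positivity)] at h2
    exact h2
  rw [norm_mul, RCLike.norm_natCast]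
  calc (k : ℝ) * ‖a k‖ * r ^ k = ‖a k‖ * (k * r ^ k) := by ring
    _ ≤ ‖a k‖ * (C * ρ ^ k) := mul_le_mul_of_nonneg_left h3 (norm_nonneg _)
    _ = C * (‖a k‖ * ρ ^ k) := by ring

theorem UnitRadius.affine_mul {a : ℕ → 𝕜} (ha : UnitRadius a) (s t : 𝕜) :
    UnitRadius fun k => (s + t * k) * a k := by
  refine ((ha.const_mul s).add (ha.nat_mul.const_mul t)).of_norm_le (C := 1) fun k => ?_
  rw [one_mul]
  exact (congrArg norm (by ring)).le

theorem pser_add {a b : ℕ → 𝕜} (ha : UnitRadius a) (hb : UnitRadius b) {z : 𝕜} (hz : ‖z‖ < 1) :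
    pser (fun k => a k + b k) z = pser a z + pser b z := by
  have := (ha.hasSum hz).add (hb.hasSum hz)
  simp only [← add_mul] at this
  exact this.tsum_eq

theorem pser_const_mul (a : ℕ → 𝕜) (c z : 𝕜) :
    pser (fun k => c * a k) z = c * pser a z := by
  simp only [pser, mul_assoc, tsum_mul_left]

theorem pser_zero (a : ℕ → 𝕜) : pser a 0 = a 0 := by
  rw [pser, tsum_eq_single 0 (fun k hk => by simp [hk])]
  simp

theorem pser_single (c z : 𝕜) : pser (fun k : ℕ => if k = 0 then c else 0) z = c := by
  rw [pser, tsum_eq_single 0 (fun k hk => by simp [hk])]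
  simp

theorem pser_affine_mul {a : ℕ → 𝕜} (ha : UnitRadius a) (s t : 𝕜) {z : 𝕜} (hz : ‖z‖ < 1) :
    pser (fun k => (s + t * k) * a k) z = s * pser a z + t * pser (fun k => k * a k) z := by
  rw [← pser_const_mul, ← pser_const_mul,
    ← pser_add (ha.const_mul s) (ha.nat_mul.const_mul t) hz]
  congr 1
  ext k
  ring

/-- Recording `z * d` instead of `d` avoids an index shift: the Euler operator acts as the
multiplier `k`. -/
theorem UnitRadius.exists_hasDerivAt {a : ℕ → 𝕜} (ha : UnitRadius a) {z : 𝕜} (hz : ‖z‖ < 1) :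
    ∃ d, HasDerivAt (pser a) d z ∧ z * d = pser (fun k => k * a k) z := by
  obtain ⟨ρ, hr, hρ⟩ := exists_between hz
  have hρ0 : 0 < ρ := (norm_nonneg z).trans_lt hr
  refine ⟨∑' k, a k * (k * z ^ (k - 1)), ?_, ?_⟩
  · have hu : Summable fun k : ℕ => ρ⁻¹ * (‖(k : 𝕜) * a k‖ * ρ ^ k) :=
      (ha.nat_mul ρ hρ0.le hρ).mul_left _
    refine hasDerivAt_tsum_of_isPreconnected (𝕜 := 𝕜) (t := Metric.ball 0 ρ) (y₀ := z) hu
      Metric.isOpen_ball ?_ (fun n y _ => (hasDerivAt_pow n y).const_mul (a n)) ?_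
      (by simpa using hr) (ha.summable hz) (by simpa using hr)
    · let _ : NormedSpace ℝ 𝕜 := NormedSpace.restrictScalars ℝ 𝕜 𝕜
      exact (convex_ball (0 : 𝕜) ρ).isPreconnected
    · intro n y hy
      have hy' : ‖y‖ ≤ ρ := by simpa using (mem_ball_zero_iff.1 hy).le
      rcases n with _ | n
      · simp
      · simp only [norm_mul, norm_pow, RCLike.norm_natCast, Nat.add_sub_cancel, pow_succ]
        calc ‖a (n + 1)‖ * (((n + 1 : ℕ) : ℝ) * ‖y‖ ^ n)
            ≤ ‖a (n + 1)‖ * (((n + 1 : ℕ) : ℝ) * ρ ^ n) := by gcongr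
          _ = ρ⁻¹ * (((n + 1 : ℕ) : ℝ) * ‖a (n + 1)‖ * (ρ ^ n * ρ)) := by
            field_simp
  · rw [← tsum_mul_left, pser]
    refine tsum_congr fun k => ?_
    rcases k with _ | k
    · simp
    · simp only [Nat.add_sub_cancel, pow_succ]
      ring

theorem UnitRadius.continuousOn {a : ℕ → 𝕜} (ha : UnitRadius a) :
    ContinuousOn (pser a) (Metric.ball 0 1) := fun z hz => by
  obtain ⟨d, hd, -⟩ := ha.exists_hasDerivAt (mem_ball_zero_iff.1 hz)
  exact hd.continuousAt.continuousWithinAt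

theorem UnitRadius.analyticOnNhd {a : ℕ → ℂ} (ha : UnitRadius a) :
    AnalyticOnNhd ℂ (pser a) (Metric.ball 0 1) := by
  refine DifferentiableOn.analyticOnNhd (fun z hz => ?_) Metric.isOpen_ball
  obtain ⟨d, hd, -⟩ := ha.exists_hasDerivAt (mem_ball_zero_iff.1 hz)
  exact hd.differentiableAt.differentiableWithinAt

/-- The derivative of `z ↦ z * pser a z` on the unit disc. -/
theorem UnitRadius.deriv_of_eqOn {a : ℕ → ℂ} (ha : UnitRadius a) {f : ℂ → ℂ}
    (hf : ∀ z ∈ Metric.ball (0 : ℂ) 1, f z = z * pser a z) {z : ℂ}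
    (hz : z ∈ Metric.ball (0 : ℂ) 1) :
    deriv f z = pser (fun k => (1 + k) * a k) z := by
  have hz' := mem_ball_zero_iff.1 hz
  obtain ⟨d, hd, hd'⟩ := ha.exists_hasDerivAt hz'
  have h1 : f =ᶠ[𝓝 z] fun w => w * pser a w :=
    eventually_of_mem (Metric.isOpen_ball.mem_nhds hz) hf
  have h2 : HasDerivAt (fun w => w * pser a w) (1 * pser a z + z * d) z :=
    (hasDerivAt_id' z).mul hd
  rw [h1.deriv_eq, h2.deriv]
  have := pser_affine_mul ha 1 1 hz'
  simp only [one_mul] at this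
  simp [this, hd']

theorem exists_pser_of_analyticOnNhd {f : ℂ → ℂ} (hf : AnalyticOnNhd ℂ f (Metric.ball 0 1)) :
    ∃ a : ℕ → ℂ, UnitRadius a ∧ ∀ z ∈ Metric.ball (0 : ℂ) 1, f z = pser a z := by
  have hs : ∀ z ∈ Metric.ball (0 : ℂ) 1,
      HasSum (fun n : ℕ => (n.factorial : ℂ)⁻¹ * iteratedDeriv n f 0 * z ^ n) (f z) := by
    intro z hz
    have := Complex.hasSum_taylorSeries_on_ball (f := f) (c := 0) (r := 1)
      (hf.differentiableOn.mono (by simp)) (z := z) (by simpa using hz)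
    refine this.congr_fun ?_
    intro n
    simp
    ring
  refine ⟨fun n => (n.factorial : ℂ)⁻¹ * iteratedDeriv n f 0, ?_,
    fun z hz => (hs z hz).tsum_eq.symm⟩
  intro r h0 h1
  have h2 := (hs (r : ℂ) (by simpa [abs_of_nonneg h0] using h1)).summable.norm
  refine h2.congr fun k => ?_
  simp [abs_of_nonneg h0]

end PowerSeries

/-! ### Moments of logarithmic weights -/

section LogMoments

/-- The weight `t ^ (A - 1) * log (1 / t) ^ (P - 1)` on `(0, 1)`. -/
noncomputable def logWeight (A P t : ℝ) : ℝ := Real.log (1 / t) ^ (P - 1) * t ^ (A - 1)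

theorem logWeight_nonneg (A P : ℝ) {t : ℝ} (ht : t ∈ Ioo (0 : ℝ) 1) : 0 ≤ logWeight A P t := by
  have : 0 ≤ Real.log (1 / t) := Real.log_nonneg (by rw [le_div_iff₀ ht.1]; linarith [ht.2])
  have := ht.1
  unfold logWeight
  positivity

theorem integral_logWeight {A P : ℝ} (hA : 0 < A) (hP : 0 < P) :
    ∫ t in Ioo (0 : ℝ) 1, logWeight A P t = Real.Gamma P / A ^ P := by
  have himg : (fun x : ℝ => Real.exp (-x)) '' Ioi 0 = Ioo 0 1 := by
    ext t
    simp only [mem_image, mem_Ioi, mem_Ioo]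
    constructor
    · rintro ⟨x, hx, rfl⟩
      exact ⟨Real.exp_pos _, by simpa using hx⟩
    · rintro ⟨h0, h1⟩
      exact ⟨-Real.log t, by linarith [Real.log_neg h0 h1], by simp [Real.exp_log h0]⟩
  -- The substitution `t = e^{-x}` gives Euler's integral for `Γ(P) / A^P`.
  rw [← himg, integral_image_eq_integral_abs_deriv_smul (f' := fun x => -Real.exp (-x))
    measurableSet_Ioi]
  · have := Real.integral_rpow_mul_exp_neg_mul_Ioi hP hA
    rw [one_div, Real.inv_rpow hA.le, inv_mul_eq_div] at this
    rw [← this]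
    refine setIntegral_congr_fun measurableSet_Ioi fun x hx => ?_
    simp only [logWeight, abs_neg, Real.abs_exp, one_div, ← Real.exp_neg, neg_neg, Real.log_exp,
      smul_eq_mul, ← Real.exp_mul]
    rw [mul_left_comm, ← Real.exp_add]
    congr 2
    ring
  · intro x hx
    have := ((hasDerivAt_id x).neg).exp
    simpa using this.hasDerivWithinAt
  · intro x _ y _ h
    simpa using h

theorem integrableOn_logWeight {A P : ℝ} (hA : 0 < A) (hP : 0 < P) :
    IntegrableOn (logWeight A P) (Ioo 0 1) := by
  have h := integral_logWeight hA hP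
  by_contra hn
  -- The integral of a non-integrable function is `0` by convention, whereas this one has a positive
  -- value.
  rw [integral_undef hn] at h
  have : 0 < Real.Gamma P / A ^ P := div_pos (Real.Gamma_pos_of_pos hP) (by positivity)
  linarith

theorem logWeight_mul_pow (A P : ℝ) {t : ℝ} (ht : t ∈ Ioo (0 : ℝ) 1) (k : ℕ) :
    logWeight A P t * t ^ k = logWeight (k + A) P t := by
  rw [logWeight, logWeight, mul_assoc, ← Real.rpow_natCast t k, ← Real.rpow_add ht.1]
  congr 2
  ring

theorem integral_logWeight_mul_pow {A P : ℝ} (hA : 0 < A) (hP : 0 < P) (k : ℕ) :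
    ∫ t in Ioo (0 : ℝ) 1, logWeight A P t * t ^ k = Real.Gamma P / (k + A) ^ P := by
  rw [← integral_logWeight (by positivity) hP]
  exact setIntegral_congr_fun measurableSet_Ioo fun t ht => logWeight_mul_pow A P ht k

/-- Termwise integration of an absolutely convergent power series against `logWeight`. -/
theorem hasSum_integral_logWeight {𝕜 : Type*} [RCLike 𝕜] {A P : ℝ} (hA : 0 < A) (hP : 0 < P)
    {a : ℕ → 𝕜} (ha : Summable fun k => ‖a k‖) :
    HasSum (fun k : ℕ => ((Real.Gamma P / (k + A) ^ P : ℝ) : 𝕜) * a k)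
      (∫ t in Ioo (0 : ℝ) 1, (logWeight A P t : 𝕜) * pser a (t : 𝕜)) := by
  have hint : ∀ k : ℕ, IntegrableOn (fun t : ℝ => logWeight A P t * t ^ k) (Ioo 0 1) := fun k =>
    (integrableOn_logWeight (A := k + A) (by positivity) hP).congr_fun
      (fun t ht => (logWeight_mul_pow A P ht k).symm) measurableSet_Ioo
  have key := hasSum_integral_of_summable_integral_norm (μ := volume.restrict (Ioo (0 : ℝ) 1))
    (F := fun (k : ℕ) (t : ℝ) => ((logWeight A P t * t ^ k : ℝ) : 𝕜) * a k)
    (fun k => ((hint k).ofReal).mul_const (a k)) ?_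
  · have h1 : (∫ t in Ioo (0 : ℝ) 1, ∑' k : ℕ, ((logWeight A P t * t ^ k : ℝ) : 𝕜) * a k)
        = ∫ t in Ioo (0 : ℝ) 1, (logWeight A P t : 𝕜) * pser a (t : 𝕜) := by
      refine setIntegral_congr_fun measurableSet_Ioo fun t _ => ?_
      simp only [pser]
      rw [← tsum_mul_left]
      refine tsum_congr fun k => ?_
      push_cast
      ring
    rw [h1] at key
    refine key.congr_fun fun k => ?_
    rw [integral_mul_const, integral_ofReal, integral_logWeight_mul_pow hA hP]
  · have h2 : ∀ k : ℕ, ∫ t in Ioo (0 : ℝ) 1, ‖((logWeight A P t * t ^ k : ℝ) : 𝕜) * a k‖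
        = Real.Gamma P / (k + A) ^ P * ‖a k‖ := by
      intro k
      rw [← integral_logWeight_mul_pow hA hP, ← integral_mul_const]
      refine setIntegral_congr_fun measurableSet_Ioo fun t ht => ?_
      simp only [norm_mul, RCLike.norm_ofReal]
      rw [abs_of_nonneg (mul_nonneg (logWeight_nonneg A P ht) (pow_nonneg ht.1.le k))]
    simp only [h2]
    have hG := Real.Gamma_pos_of_pos hP
    refine Summable.of_nonneg_of_le (fun k => by positivity) (fun k => ?_)
      (ha.mul_left (Real.Gamma P / A ^ P))
    gcongr
    linarith [k.cast_nonneg (α := ℝ)]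

end LogMoments

/-! ### Multipliers preserving nonnegativity on the unit interval -/

section Positivity

/-- Absolutely summable real power series that are nonnegative on `[0, 1]`. -/
def PosOnUnit (a : ℕ → ℝ) : Prop :=
  (Summable fun k => |a k|) ∧ ∀ s ∈ Icc (0 : ℝ) 1, 0 ≤ pser a s

theorem PosOnUnit.summable_pow {a : ℕ → ℝ} (ha : PosOnUnit a) {s : ℝ} (hs : s ∈ Icc (0 : ℝ) 1) :
    Summable fun k => a k * s ^ k := by
  refine Summable.of_norm_bounded ha.1 fun k => ?_
  rw [norm_mul, norm_pow, Real.norm_eq_abs, Real.norm_of_nonneg hs.1]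
  exact mul_le_of_le_one_right (abs_nonneg _) (pow_le_one₀ hs.1 hs.2)

theorem PosOnUnit.add {a b : ℕ → ℝ} (ha : PosOnUnit a) (hb : PosOnUnit b) :
    PosOnUnit fun k => a k + b k := by
  refine ⟨Summable.of_nonneg_of_le (fun _ => abs_nonneg _) (fun k => abs_add_le (a k) (b k))
    (ha.1.add hb.1), fun s hs => ?_⟩
  simp only [pser, add_mul]
  rw [(ha.summable_pow hs).tsum_add (hb.summable_pow hs)]
  exact add_nonneg (ha.2 s hs) (hb.2 s hs)

theorem PosOnUnit.const_mul {a : ℕ → ℝ} (ha : PosOnUnit a) {C : ℝ} (hC : 0 ≤ C) :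
    PosOnUnit fun k => C * a k := by
  refine ⟨?_, fun s hs => ?_⟩
  · simpa only [abs_mul] using ha.1.mul_left |C|
  · rw [pser_const_mul]
    exact mul_nonneg hC (ha.2 s hs)

theorem PosOnUnit.tsum_nonneg {a : ℕ → ℝ} (ha : PosOnUnit a) : 0 ≤ ∑' k, a k := by
  simpa [pser] using ha.2 1 (by simp)

/-- Multiplier sequences preserving nonnegativity on `[0, 1]`. -/
def IsPosMultiplier (e : ℕ → ℝ) : Prop :=
  ∀ a : ℕ → ℝ, PosOnUnit a → PosOnUnit fun k => e k * a k

theorem IsPosMultiplier.const {C : ℝ} (hC : 0 ≤ C) : IsPosMultiplier fun _ => C :=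
  fun _ ha => ha.const_mul hC

theorem IsPosMultiplier.add {e e' : ℕ → ℝ} (he : IsPosMultiplier e) (he' : IsPosMultiplier e') :
    IsPosMultiplier fun k => e k + e' k := fun a ha => by
  simpa only [add_mul] using (he a ha).add (he' a ha)

theorem IsPosMultiplier.mul {e e' : ℕ → ℝ} (he : IsPosMultiplier e) (he' : IsPosMultiplier e') :
    IsPosMultiplier fun k => e k * e' k := fun a ha => by
  simpa only [mul_assoc] using he _ (he' a ha)

theorem IsPosMultiplier.congr {e e' : ℕ → ℝ} (he : IsPosMultiplier e) (h : ∀ k, e k = e' k) :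
    IsPosMultiplier e' :=
  funext h ▸ he

/-- Since `Γ(P)/(k+A)^P` is the `k`-th moment of `logWeight A P`, the new sum at `s` is a positive
average of the old sums at `s t`, `0 < t < 1`. -/
theorem isPosMultiplier_inv_rpow {A P : ℝ} (hA : 0 < A) (hP : 0 < P) :
    IsPosMultiplier fun k => 1 / ((k : ℝ) + A) ^ P := by
  intro a ha
  have hG := Real.Gamma_pos_of_pos hP
  have hrw : (fun k : ℕ => 1 / ((k : ℝ) + A) ^ P * a k)
      = fun k : ℕ => (Real.Gamma P)⁻¹ * (Real.Gamma P / (k + A) ^ P * a k) := by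
    ext k
    field_simp
  rw [hrw]
  refine PosOnUnit.const_mul ⟨?_, fun s hs => ?_⟩ (inv_nonneg.2 hG.le)
  · refine Summable.of_nonneg_of_le (fun _ => abs_nonneg _) (fun k => ?_)
      (ha.1.mul_left (Real.Gamma P / A ^ P))
    rw [abs_mul, abs_of_nonneg (by positivity)]
    gcongr
    linarith [k.cast_nonneg (α := ℝ)]
  · have hs' : Summable fun k => ‖a k * s ^ k‖ := (ha.summable_pow hs).norm
    have := (hasSum_integral_logWeight hA hP hs').tsum_eq
    simp only [RCLike.ofReal_real_eq_id, id, ← mul_assoc] at this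
    rw [pser, this]
    refine setIntegral_nonneg measurableSet_Ioo fun t ht => ?_
    refine mul_nonneg (logWeight_nonneg A P ht) ?_
    have := ha.2 (s * t) ⟨mul_nonneg hs.1 ht.1.le, mul_le_one₀ hs.2 ht.1.le ht.2.le⟩
    simpa only [pser, mul_pow, mul_assoc] using this

theorem isPosMultiplier_inv_one_add {ν : ℝ} (hν : 0 < ν) :
    IsPosMultiplier fun k => 1 / (1 + ν * k) := by
  refine ((isPosMultiplier_inv_rpow (A := 1 / ν) (P := 1) (by positivity) one_pos).mul
    (IsPosMultiplier.const (C := 1 / ν) (by positivity))).congr fun k => ?_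
  rw [Real.rpow_one]
  field_simp
  ring

end Positivity

/-! ### Pointwise lower bound for the kernel -/

section KernelBound

/-- The minimum over `|v| = 1` of
`Re (1 / (1 - u) + (1 + v) / 2 * (u / (1 - u) ^ 2)) - 1 / (1 + |u|) ^ 2`,
for `u` of modulus `t` and real part `t * c`. -/
noncomputable def kernelMin (c t : ℝ) : ℝ :=
  t * (1 + c) / 2 * ((2 - 4 * t - 2 * t ^ 2) * (1 + t ^ 2 - 2 * t * c) + (1 - t ^ 2) ^ 2) /
    ((1 + t) * (1 + t ^ 2 - 2 * t * c)) ^ 2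

/-- The auxiliary function whose product with `log (1 / t)` has a derivative controlled by
`log (1 / t) * kernelMin c t`. -/
noncomputable def comparison (c t : ℝ) : ℝ :=
  t * (2 * t - t ^ 2 - t ^ 3) / ((1 + t) * (1 + t ^ 2 - 2 * t * c))

/-- The derivative of `comparison c`. -/
noncomputable def comparisonDeriv (c t : ℝ) : ℝ :=
  ((4 * t - 3 * t ^ 2 - 4 * t ^ 3) * ((1 + t) * (1 + t ^ 2 - 2 * t * c)) -
    t * (2 * t - t ^ 2 - t ^ 3) *
      ((1 + t ^ 2 - 2 * t * c) + (1 + t) * (2 * t - 2 * c))) /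
    ((1 + t) * (1 + t ^ 2 - 2 * t * c)) ^ 2

theorem one_add_sq_sub_pos {c t : ℝ} (hc : c ≤ 1) (h0 : 0 ≤ t) (h1 : t < 1) :
    0 < 1 + t ^ 2 - 2 * t * c := by
  have : 0 < (1 - t) ^ 2 := by have := sub_pos.2 h1; positivity
  nlinarith [mul_nonneg h0 (sub_nonneg.2 hc)]

theorem hasDerivAt_comparison {c t : ℝ} (hc : c ≤ 1) (h0 : 0 ≤ t) (h1 : t < 1) :
    HasDerivAt (comparison c) (comparisonDeriv c t) t := by
  have hD := one_add_sq_sub_pos hc h0 h1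
  have hx := hasDerivAt_id' t
  have hn : HasDerivAt (fun t : ℝ => t * (2 * t - t ^ 2 - t ^ 3))
      (4 * t - 3 * t ^ 2 - 4 * t ^ 3) t := by
    refine (hx.mul (((hx.const_mul 2).sub (hx.pow 2)).sub (hx.pow 3))).congr_deriv ?_
    norm_num
    ring
  have hm : HasDerivAt (fun t : ℝ => (1 + t) * (1 + t ^ 2 - 2 * t * c))
      ((1 + t ^ 2 - 2 * t * c) + (1 + t) * (2 * t - 2 * c)) t := by
    refine ((hx.const_add 1).mul (((hx.pow 2).const_add 1).sub
      ((hx.const_mul 2).mul_const c))).congr_deriv ?_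
    norm_num
  exact hn.div hm (by positivity)

theorem le_mul_kernelMin {c t l : ℝ} (hc0 : -1 ≤ c) (hc1 : c ≤ 1) (h0 : 0 < t) (h1 : t < 1)
    (hl0 : 0 ≤ l) (hl : l ≤ (1 - t ^ 2) / (2 * t)) :
    (1 + c) / 6 * (l * comparisonDeriv c t - comparison c t / t) ≤ l * kernelMin c t := by
  have hD := one_add_sq_sub_pos hc1 h0.le h1
  set D := 1 + t ^ 2 - 2 * t * c with hDdef
  have hM : 0 < (1 + t) * D := by positivity
  -- Over the common denominator `((1+t)D)²`, the right side minus the left is `(1+c)/6` times `l p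
  -- + (2t - t² - t³)(1+t)D`, which is affine in `l`.
  set p : ℝ := 3 * t * ((2 - 4 * t - 2 * t ^ 2) * D + (1 - t ^ 2) ^ 2) -
    ((4 * t - 3 * t ^ 2 - 4 * t ^ 3) * ((1 + t) * D) -
    t * (2 * t - t ^ 2 - t ^ 3) * (D + (1 + t) * (2 * t - 2 * c))) with hp
  have hq : 0 ≤ (2 * t - t ^ 2 - t ^ 3) * ((1 + t) * D) := by
    refine mul_nonneg ?_ hM.le
    have : 2 * t - t ^ 2 - t ^ 3 = t * (1 - t) * (2 + t) := by ring
    rw [this]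
    have := sub_pos.2 h1
    positivity
  -- By affineness in `l` it suffices to check `l = 0`, which is `hq`, and `l = (1-t²)/(2t)`. The
  -- latter expression is also affine in `c`, so it interpolates between its values at `c = -1` and
  -- `c = 1`, both of which factor.
  have hend : 0 ≤ (1 - t ^ 2) * p + 2 * t * ((2 * t - t ^ 2 - t ^ 3) * ((1 + t) * D)) := by
    have : (1 - t ^ 2) * p + 2 * t * ((2 * t - t ^ 2 - t ^ 3) * ((1 + t) * D)) =
        (1 - c) / 2 * (t * (1 - t) ^ 3 * (1 + t) ^ 3 * (5 + t)) +
        (1 + c) / 2 * (t * (1 - t) ^ 4 * (1 + t) * (5 - t ^ 2)) := by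
      rw [hp, hDdef]; ring
    rw [this]
    have h2 := sub_pos.2 h1
    have h3 : 0 ≤ 1 - c := by linarith
    have h4 : 0 ≤ 1 + c := by linarith
    have h5 : 0 < 5 - t ^ 2 := by nlinarith
    positivity
  have hlin : 0 ≤ l * p + (2 * t - t ^ 2 - t ^ 3) * ((1 + t) * D) := by
    rcases le_or_gt 0 p with h | h
    · positivity
    · have h2 : (1 - t ^ 2) / (2 * t) * p ≤ l * p := mul_le_mul_of_nonpos_right hl h.le
      have h3 : (1 - t ^ 2) / (2 * t) * p + (2 * t - t ^ 2 - t ^ 3) * ((1 + t) * D) =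
        ((1 - t ^ 2) * p + 2 * t * ((2 * t - t ^ 2 - t ^ 3) * ((1 + t) * D))) / (2 * t) := by
        field_simp
      have h4 := div_nonneg hend (by positivity : 0 ≤ 2 * t)
      linarith
  have hid : l * kernelMin c t - (1 + c) / 6 * (l * comparisonDeriv c t - comparison c t / t) =
      (1 + c) / 6 * ((l * p + (2 * t - t ^ 2 - t ^ 3) * ((1 + t) * D)) / ((1 + t) * D) ^ 2) := by
    rw [kernelMin, comparisonDeriv, comparison, ← hDdef, hp]
    field_simp
    ring
  have : 0 ≤ (1 + c) / 6 * ((l * p + (2 * t - t ^ 2 - t ^ 3) * ((1 + t) * D)) /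
      ((1 + t) * D) ^ 2) :=
    mul_nonneg (by linarith) (div_nonneg hlin (by positivity))
  linarith

theorem log_one_div_le {t : ℝ} (h0 : 0 < t) (h1 : t < 1) :
    Real.log (1 / t) ≤ (1 - t ^ 2) / (2 * t) := by
  have hd : ∀ x ∈ Icc t 1, HasDerivAt (fun x : ℝ => (1 - x ^ 2) / (2 * x) - Real.log (1 / x))
      (-(1 - x) ^ 2 / (2 * x ^ 2)) x := by
    intro x hx
    have hx0 : x ≠ 0 := (h0.trans_le hx.1).ne'
    have hx := hasDerivAt_id' x
    have h2 := (((hx.pow 2).const_sub 1).div (hx.const_mul 2) (by positivity)).add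
      (Real.hasDerivAt_log hx0)
    simp only [one_div, Real.log_inv, sub_neg_eq_add]
    refine h2.congr_deriv ?_
    norm_num
    field_simp
    ring
  have hanti : AntitoneOn (fun x : ℝ => (1 - x ^ 2) / (2 * x) - Real.log (1 / x)) (Icc t 1) := by
    refine antitoneOn_of_deriv_nonpos (convex_Icc t 1)
      (fun x hx => (hd x hx).continuousAt.continuousWithinAt)
      (fun x hx => (hd x (interior_subset hx)).differentiableAt.differentiableWithinAt)
      fun x hx => ?_
    rw [(hd x (interior_subset hx)).deriv]
    exact div_nonpos_of_nonpos_of_nonneg (by nlinarith [sq_nonneg (1 - x)]) (by positivity)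
  have := hanti (left_mem_Icc.2 h1.le) (right_mem_Icc.2 h1.le) h1.le
  simp only [one_div, Real.log_inv] at this ⊢
  norm_num at this
  linarith

/-- Only `v u/(1-u)²` depends on `v`, and its real part is at least minus its modulus `|u|/|1-u|²`.
The rest is algebra in `D = |1-u|²`. -/
theorem kernelMin_le_re {u v : ℂ} (hu : ‖u‖ < 1) (hv : ‖v‖ = 1) {c : ℝ} (hc : u.re = ‖u‖ * c) :
    kernelMin c ‖u‖ ≤
      (1 / (1 - u) + (1 + v) / 2 * (u / (1 - u) ^ 2)).re - 1 / (1 + ‖u‖) ^ 2 := by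
  set t := ‖u‖ with ht
  have h0 : 0 ≤ t := norm_nonneg u
  have hsq : u.re * u.re + u.im * u.im = t ^ 2 := by
    rw [ht, ← Complex.normSq_eq_norm_sq, Complex.normSq_apply]
  have hD' : Complex.normSq (1 - u) = 1 + t ^ 2 - 2 * u.re := by
    rw [Complex.normSq_apply]
    simp
    nlinarith
  have hDn : ‖1 - u‖ ^ 2 = 1 + t ^ 2 - 2 * u.re := by
    rw [← hD', Complex.normSq_eq_norm_sq]
  have hne : 1 - u ≠ 0 := fun h => by
    have : u = 1 := by linear_combination -h
    rw [ht, this] at hu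
    simp at hu
  have hD : 0 < 1 + t ^ 2 - 2 * u.re := by
    rw [← hDn]; have := norm_pos_iff.2 hne; positivity
  set D := 1 + t ^ 2 - 2 * u.re with hDdef
  have hinv : (1 - u)⁻¹ = (D⁻¹ : ℝ) * (1 - (starRingEnd ℂ) u) := by
    rw [Complex.inv_def, hD', mul_comm]
    simp
  have h1 : (1 / (1 - u)).re = (1 - u.re) / D := by
    rw [one_div, hinv, Complex.re_ofReal_mul]
    simp
    ring
  have h2 : (u / (1 - u) ^ 2).re = (u.re * (1 + t ^ 2) - 2 * t ^ 2) / D ^ 2 := by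
    rw [div_eq_mul_inv, ← inv_pow, hinv, mul_pow, mul_left_comm, ← Complex.ofReal_pow,
      Complex.re_ofReal_mul]
    simp only [Complex.mul_re, pow_two, Complex.sub_re, Complex.sub_im, Complex.one_re,
      Complex.one_im, Complex.conj_re, Complex.conj_im, Complex.mul_im]
    field_simp
    rw [← hsq]
    ring
  have h3 : -(t / D) ≤ (v * (u / (1 - u) ^ 2)).re := by
    have : ‖v * (u / (1 - u) ^ 2)‖ = t / D := by
      rw [norm_mul, hv, norm_div, norm_pow, hDn, one_mul]
    rw [← this]
    exact (abs_le.1 (Complex.abs_re_le_norm _)).1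
  have h4 : (1 / (1 - u) + (1 + v) / 2 * (u / (1 - u) ^ 2)).re =
      (1 / (1 - u)).re + (u / (1 - u) ^ 2).re / 2 + (v * (u / (1 - u) ^ 2)).re / 2 := by
    have : (1 / (1 - u) + (1 + v) / 2 * (u / (1 - u) ^ 2)) =
      1 / (1 - u) + (u / (1 - u) ^ 2) / 2 + (v * (u / (1 - u) ^ 2)) / 2 := by ring
    rw [this]
    simp only [Complex.add_re, Complex.div_ofNat_re]
  have h5 : kernelMin c t = (1 - u.re) / D + (u.re * (1 + t ^ 2) - 2 * t ^ 2) / D ^ 2 / 2 +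
      (-(t / D)) / 2 - 1 / (1 + t) ^ 2 := by
    have h6 : 1 + t ^ 2 - 2 * t * c = D := by rw [hDdef, hc]; ring
    have h7 : t * (1 + c) = t + u.re := by rw [hc]; ring
    rw [kernelMin, h6, h7]
    have h8 : u.re = (1 + t ^ 2 - D) / 2 := by rw [hDdef]; ring
    rw [h8]
    field_simp
    ring
  rw [h4, h5, h1, h2]
  linarith

end KernelBound

/-! ### The base inequality with weight `log (1/t)` -/

section BasePositivity

theorem hasSum_kernel {u : ℂ} (hu : ‖u‖ < 1) (w : ℂ) :
    HasSum (fun k : ℕ => (1 + w * k) * u ^ k) (1 / (1 - u) + w * (u / (1 - u) ^ 2)) := by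
  have h := (hasSum_geometric_of_norm_lt_one hu).add
    ((hasSum_coe_mul_geometric_of_norm_lt_one hu).mul_left w)
  rw [inv_eq_one_div] at h
  exact h.congr_fun fun k => by ring

theorem hasSum_inv_one_add_sq {x : ℝ} (h0 : 0 ≤ x) (h1 : x < 1) :
    HasSum (fun k : ℕ => ((k : ℝ) + 1) * (-x) ^ k) (1 / (1 + x) ^ 2) := by
  have hx : ‖-x‖ < 1 := by rwa [norm_neg, Real.norm_of_nonneg h0]
  have h := (hasSum_coe_mul_geometric_of_norm_lt_one hx).add (hasSum_geometric_of_norm_lt_one hx)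
  have h2 : 1 / (1 + x) ^ 2 = -x / (1 - -x) ^ 2 + (1 - -x)⁻¹ := by
    have : 1 + x ≠ 0 := by positivity
    rw [sub_neg_eq_add]
    field_simp
    ring
  rw [h2]
  exact h.congr_fun fun k => by ring

/-- The coefficients of `Re (∑ (1 + w k) z ^ k) - 1 / (1 + |z|) ^ 2`, `w = (1 + v) / 2`. -/
noncomputable def gapCoeff (v z : ℂ) (k : ℕ) : ℝ :=
  ((1 + (1 + v) / 2 * k) * z ^ k).re - ((k : ℝ) + 1) * (-‖z‖) ^ k

theorem gapCoeff_mul_pow (v z : ℂ) {s : ℝ} (hs : 0 ≤ s) (k : ℕ) :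
    gapCoeff v z k * s ^ k = gapCoeff v (s * z) k := by
  have : (1 + (1 + v) / 2 * k) * (s * z) ^ k =
      ((s ^ k : ℝ) : ℂ) * ((1 + (1 + v) / 2 * k) * z ^ k) := by
    push_cast; ring
  rw [gapCoeff, gapCoeff, this, Complex.re_ofReal_mul, norm_mul, Complex.norm_real,
    Real.norm_of_nonneg hs, ← mul_neg, mul_pow]
  ring

theorem hasSum_gapCoeff (v : ℂ) {z : ℂ} (hz : ‖z‖ < 1) :
    HasSum (gapCoeff v z)
      ((1 / (1 - z) + (1 + v) / 2 * (z / (1 - z) ^ 2)).re - 1 / (1 + ‖z‖) ^ 2) :=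
  (Complex.hasSum_re (hasSum_kernel hz _)).sub (hasSum_inv_one_add_sq (norm_nonneg z) hz)

theorem logWeight_one_two (t : ℝ) : logWeight 1 2 t = Real.log (1 / t) := by
  rw [logWeight]
  norm_num

theorem tsum_gapCoeff_nonneg {v z : ℂ} (hz : ‖z‖ < 1) (hv : ‖v‖ = 1) :
    0 ≤ ∑' k : ℕ, 1 / ((k : ℝ) + 1) ^ (2 : ℝ) * gapCoeff v z k := by
  have hsum : Summable fun k => ‖gapCoeff v z k‖ := (hasSum_gapCoeff v hz).summable.norm
  have hint := (hasSum_integral_logWeight (A := 1) (P := 2) one_pos two_pos hsum).tsum_eq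
  have hG : Real.Gamma 2 = 1 := Real.Gamma_two
  simp only [RCLike.ofReal_real_eq_id, id, hG] at hint
  rw [hint, ← integral_Icc_eq_integral_Ioo]
  -- Without integrability the integral is `0` by convention and the claim is trivial.
  by_cases hI : IntegrableOn (fun t => logWeight 1 2 t * pser (gapCoeff v z) t) (Icc 0 1)
  swap
  · rw [integral_undef hI]
  rcases eq_or_ne z 0 with rfl | hz0
  · have : ∀ t, pser (gapCoeff v 0) t = 0 := by
      intro t
      have : ∀ k, gapCoeff v 0 k = 0 := by
        intro k
        rcases k with _ | k <;> simp [gapCoeff]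
      simp [pser, this]
    simp [this]
  set r := ‖z‖ with hr
  have hr0 : 0 < r := norm_pos_iff.2 hz0
  set c := z.re / r with hc
  have hzc : z.re = r * c := by rw [hc]; field_simp
  have hcabs : |c| ≤ 1 := by
    rw [hc, abs_div, abs_of_pos hr0, div_le_one hr0]
    exact Complex.abs_re_le_norm z
  obtain ⟨hc0, hc1⟩ := abs_le.1 hcabs
  -- Here `c` is the cosine of the argument of `z`. Since `g(0) = g(1) = 0`, it is enough that `g'`
  -- is at most the integrand. The factor `1/r` compensates for the chain rule.
  set g : ℝ → ℝ := fun t => (1 + c) / (6 * r) * (Real.log (1 / t) * comparison c (r * t)) with hg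
  set g' : ℝ → ℝ := fun t => (1 + c) / (6 * r) * (-1 / t * comparison c (r * t) +
    Real.log (1 / t) * (comparisonDeriv c (r * t) * r)) with hg'
  have hrt : ∀ t ∈ Icc (0 : ℝ) 1, 0 ≤ r * t ∧ r * t < 1 := fun t ht =>
    ⟨mul_nonneg hr0.le ht.1, (mul_le_of_le_one_right hr0.le ht.2).trans_lt hz⟩
  have hcont : ContinuousOn g (Icc 0 1) := by
    -- A factor `t` of `comparison` tames the logarithm at `0`: `t log t` is continuous there.
    have hEq : g = fun t => (1 + c) / (6 * r) * (-(t * Real.log t) *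
        (r * (2 * (r * t) - (r * t) ^ 2 - (r * t) ^ 3) /
          ((1 + r * t) * (1 + (r * t) ^ 2 - 2 * (r * t) * c)))) := by
      ext t
      simp only [hg, comparison, one_div, Real.log_inv]
      ring
    rw [hEq]
    refine ContinuousOn.mul continuousOn_const (ContinuousOn.mul
      Real.continuous_mul_log.neg.continuousOn (ContinuousOn.div (by fun_prop) (by fun_prop) ?_))
    intro t ht
    have h1 := hrt t ht
    have := one_add_sq_sub_pos hc1 h1.1 h1.2
    have := h1.1
    positivity
  have hderiv : ∀ t ∈ Ioo (0 : ℝ) 1, HasDerivWithinAt g (g' t) (Ioi t) t := by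
    intro t ht
    have h1 := hrt t (Ioo_subset_Icc_self ht)
    have hlog : HasDerivAt (fun t : ℝ => Real.log (1 / t)) (-1 / t) t := by
      simp only [one_div, Real.log_inv]
      exact (Real.hasDerivAt_log ht.1.ne').neg.congr_deriv (by ring)
    have hcmp : HasDerivAt (fun t : ℝ => comparison c (r * t)) (comparisonDeriv c (r * t) * r) t :=
      (hasDerivAt_comparison hc1 h1.1 h1.2).comp t
        (((hasDerivAt_id' t).const_mul r).congr_deriv (by ring))
    exact ((hlog.mul hcmp).const_mul _).hasDerivWithinAt
  have hle : ∀ t ∈ Ioo (0 : ℝ) 1, g' t ≤ logWeight 1 2 t * pser (gapCoeff v z) t := by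
    intro t ht
    have h1 := hrt t (Ioo_subset_Icc_self ht)
    have hrt0 : 0 < r * t := mul_pos hr0 ht.1
    have hl0 : 0 ≤ Real.log (1 / t) :=
      Real.log_nonneg (by rw [le_div_iff₀ ht.1]; linarith [ht.2])
    have hl : Real.log (1 / t) ≤ (1 - (r * t) ^ 2) / (2 * (r * t)) := by
      refine le_trans (Real.log_le_log (by have := ht.1; positivity) ?_)
        (log_one_div_le hrt0 h1.2)
      exact one_div_le_one_div_of_le hrt0 (mul_le_of_le_one_left ht.1.le hz.le)
    have hnorm : ‖(t : ℂ) * z‖ = r * t := by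
      rw [norm_mul, Complex.norm_real, Real.norm_of_nonneg ht.1.le, mul_comm]
    have hu : ‖(t : ℂ) * z‖ < 1 := hnorm ▸ h1.2
    have h2 := kernelMin_le_re hu hv (c := c)
      (by rw [hnorm, Complex.re_ofReal_mul, hzc]; ring)
    rw [← (hasSum_gapCoeff v hu).tsum_eq, hnorm] at h2
    have h3 : pser (gapCoeff v z) t = ∑' k, gapCoeff v (t * z) k :=
      tsum_congr fun k => gapCoeff_mul_pow v z ht.1.le k
    rw [h3, logWeight_one_two]
    refine le_trans ?_ (mul_le_mul_of_nonneg_left h2 hl0)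
    refine le_trans (le_of_eq ?_) (le_mul_kernelMin hc0 hc1 hrt0 h1.2 hl0 hl)
    have := ht.1.ne'
    simp only [hg']
    field_simp
    ring
  have hFTC := intervalIntegral.sub_le_integral_of_hasDeriv_right_of_le zero_le_one hcont hderiv
    hI hle
  rw [intervalIntegral.integral_of_le zero_le_one, ← integral_Icc_eq_integral_Ioc] at hFTC
  refine le_trans (le_of_eq ?_) hFTC
  simp [hg]

theorem posOnUnit_gapCoeff {v z : ℂ} (hz : ‖z‖ < 1) (hv : ‖v‖ = 1) :
    PosOnUnit fun k => 1 / ((k : ℝ) + 1) ^ (2 : ℝ) * gapCoeff v z k := by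
  refine ⟨?_, fun s hs => ?_⟩
  · refine Summable.of_nonneg_of_le (fun _ => abs_nonneg _) (fun k => ?_)
      (hasSum_gapCoeff v hz).summable.norm
    rw [abs_mul, Real.norm_eq_abs]
    refine mul_le_of_le_one_left (abs_nonneg _) ?_
    have h1 : (1 : ℝ) ≤ ((k : ℝ) + 1) ^ (2 : ℝ) :=
      Real.one_le_rpow (by linarith [k.cast_nonneg (α := ℝ)]) (by norm_num)
    rw [abs_of_nonneg (by positivity)]
    exact (div_le_one (by positivity)).2 h1
  · have h : ‖(s : ℂ) * z‖ < 1 := by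
      rw [norm_mul, Complex.norm_real, Real.norm_of_nonneg hs.1]
      exact (mul_le_of_le_one_left (norm_nonneg z) hs.2).trans_lt hz
    refine (tsum_gapCoeff_nonneg h hv).trans_eq (tsum_congr fun k => ?_)
    rw [← gapCoeff_mul_pow v z hs.1]
    ring

end BasePositivity

/-! ### The kernel and Komatu multipliers -/

section Coefficients

/-- The coefficients of the `μ, ν` integral operator inverting
`a ↦ (1 + μ k) (1 + ν k) a`. -/
noncomputable def kernelCoeff (μ ν : ℝ) (k : ℕ) : ℝ := 1 / ((1 + μ * k) * (1 + ν * k))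

/-- The coefficients of the Komatu operator. -/
noncomputable def komatuCoeff (c p : ℝ) (k : ℕ) : ℝ := ((c + 1) / (k + (c + 1))) ^ p

theorem isPosMultiplier_kernelCoeff {μ ν : ℝ} (hμ : 0 < μ) (hν : 0 < ν) :
    IsPosMultiplier (kernelCoeff μ ν) :=
  ((isPosMultiplier_inv_one_add hμ).mul (isPosMultiplier_inv_one_add hν)).congr fun k => by
    rw [kernelCoeff, one_div_mul_one_div]

/-- `(k+1)/(1+μk) = 1/μ + ((μ-1)/μ)/(1+μk)`, with nonnegative coefficients exactly because `μ ≥ 1`.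
-/
theorem isPosMultiplier_succ_mul_kernelCoeff {μ ν : ℝ} (hμ : 1 ≤ μ) (hν : 0 < ν) :
    IsPosMultiplier fun k => ((k : ℝ) + 1) * kernelCoeff μ ν k := by
  have hμ0 : 0 < μ := by linarith
  refine (((IsPosMultiplier.const (C := 1 / μ) (by positivity)).add
    ((IsPosMultiplier.const (C := (μ - 1) / μ) (div_nonneg (by linarith) hμ0.le)).mul
      (isPosMultiplier_inv_one_add hμ0))).mul (isPosMultiplier_inv_one_add hν)).congr fun k => ?_
  rw [kernelCoeff]
  field_simp
  ring

theorem isPosMultiplier_komatuCoeff {c p : ℝ} (hc : -1 < c) (hp : 0 < p) :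
    IsPosMultiplier (komatuCoeff c p) := by
  have hc' : 0 < c + 1 := by linarith
  refine ((IsPosMultiplier.const (C := (c + 1) ^ p) (by positivity)).mul
    (isPosMultiplier_inv_rpow hc' hp)).congr fun k => ?_
  rw [komatuCoeff, Real.div_rpow hc'.le (by positivity), mul_one_div]

/-- Dividing out the factor `1 / (k + 1) ^ 2` leaves a multiplier. -/
theorem exists_isPosMultiplier_komatuCoeff {c p : ℝ} (hc1 : -1 < c) (hc0 : c < 0) (hp : 2 < p) :
    ∃ m, IsPosMultiplier m ∧ ∀ k : ℕ, komatuCoeff c p k = m k * (1 / ((k : ℝ) + 1) ^ (2 : ℝ)) := by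
  have hc' : 0 < c + 1 := by linarith
  -- This is `(k+1)/(k+c+1)`. Its square times `1/(k+c+1)^{p-2}` is `(k+1)²/(k+c+1)^p`; positivity
  -- uses `c < 0` and `p > 2`.
  have h1 : IsPosMultiplier fun k => 1 + -c * (1 / ((k : ℝ) + (c + 1)) ^ (1 : ℝ)) :=
    (IsPosMultiplier.const zero_le_one).add
      ((IsPosMultiplier.const (by linarith)).mul (isPosMultiplier_inv_rpow hc' one_pos))
  refine ⟨_, (IsPosMultiplier.const (C := (c + 1) ^ p) (by positivity)).mul
    ((h1.mul h1).mul (isPosMultiplier_inv_rpow hc' (P := p - 2) (by linarith))), fun k => ?_⟩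
  have hk : (0 : ℝ) < k + (c + 1) := by positivity
  rw [komatuCoeff, Real.div_rpow hc'.le hk.le, Real.rpow_sub hk, Real.rpow_one, Real.rpow_two,
    Real.rpow_two]
  have := Real.rpow_pos_of_pos hk p
  field_simp
  ring

end Coefficients

/-! ### Explicit real generating functions -/

section RealSeries

theorem hasSum_succ_sq {x : ℝ} (h0 : 0 ≤ x) (h1 : x < 1) :
    HasSum (fun k : ℕ => ((k : ℝ) + 1) ^ 2 * (-x) ^ k) ((1 - x) / (1 + x) ^ 3) := by
  have hx : ‖-x‖ < 1 := by rwa [norm_neg, Real.norm_of_nonneg h0]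
  have h := ((hasSum_choose_mul_geometric_of_norm_lt_one 2 hx).mul_left 2).sub
    (hasSum_inv_one_add_sq h0 h1)
  have h2 : (1 - x) / (1 + x) ^ 3 = 2 * (1 / (1 - -x) ^ (2 + 1)) - 1 / (1 + x) ^ 2 := by
    have : 1 + x ≠ 0 := by positivity
    rw [sub_neg_eq_add]
    field_simp
    ring
  rw [h2]
  refine h.congr_fun fun k => ?_
  rw [Nat.cast_choose_two]
  push_cast
  ring

theorem hasSum_mul_succ {x : ℝ} (h0 : 0 ≤ x) (h1 : x < 1) :
    HasSum (fun k : ℕ => -(k * ((k : ℝ) + 1) * (-x) ^ k)) (2 * x / (1 + x) ^ 3) := by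
  have h := (hasSum_inv_one_add_sq h0 h1).sub (hasSum_succ_sq h0 h1)
  have h2 : 2 * x / (1 + x) ^ 3 = 1 / (1 + x) ^ 2 - (1 - x) / (1 + x) ^ 3 := by
    have : 1 + x ≠ 0 := by positivity
    field_simp
    ring
  rw [h2]
  exact h.congr_fun fun k => by ring

theorem mul_mem_unit {r s : ℝ} (h0 : 0 ≤ r) (h1 : r < 1) (hs : s ∈ Icc (0 : ℝ) 1) :
    0 ≤ r * s ∧ r * s < 1 :=
  ⟨mul_nonneg h0 hs.1, (mul_le_of_le_one_right h0 hs.2).trans_lt h1⟩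

theorem posOnUnit_mul_succ {r : ℝ} (h0 : 0 ≤ r) (h1 : r < 1) :
    PosOnUnit fun k => -(k * ((k : ℝ) + 1) * (-r) ^ k) := by
  refine ⟨(hasSum_mul_succ h0 h1).summable.norm, fun s hs => ?_⟩
  obtain ⟨h2, h3⟩ := mul_mem_unit h0 h1 hs
  have := (hasSum_mul_succ h2 h3).tsum_eq
  have h4 : pser (fun k => -(k * ((k : ℝ) + 1) * (-r) ^ k)) s = 2 * (r * s) / (1 + r * s) ^ 3 := by
    rw [← this]
    exact tsum_congr fun k => by rw [← neg_mul r s, mul_pow]; ring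
  rw [h4]
  positivity

theorem posOnUnit_succ_sq {r : ℝ} (h0 : 0 ≤ r) (h1 : r < 1) :
    PosOnUnit fun k => ((k : ℝ) + 1) ^ 2 * (-r) ^ k := by
  refine ⟨(hasSum_succ_sq h0 h1).summable.norm, fun s hs => ?_⟩
  obtain ⟨h2, h3⟩ := mul_mem_unit h0 h1 hs
  have := (hasSum_succ_sq h2 h3).tsum_eq
  have h4 : pser (fun k => ((k : ℝ) + 1) ^ 2 * (-r) ^ k) s = (1 - r * s) / (1 + r * s) ^ 3 := by
    rw [← this]
    exact tsum_congr fun k => by rw [← neg_mul r s, mul_pow]; ring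
  rw [h4]
  exact div_nonneg (by linarith) (by positivity)

/-- `(1-x)/(1+x)³` is decreasing on `[0, 1)`; after applying `kernelCoeff` this becomes the
monotonicity of `q`. -/
theorem posOnUnit_succ_sq_sub {r r' : ℝ} (h0 : 0 ≤ r) (hr : r ≤ r') (h1 : r' < 1) :
    PosOnUnit fun k => ((k : ℝ) + 1) ^ 2 * ((-r) ^ k - (-r') ^ k) := by
  have hr1 := hr.trans_lt h1
  have hr0 := h0.trans hr
  have hrw : (fun k : ℕ => ((k : ℝ) + 1) ^ 2 * ((-r) ^ k - (-r') ^ k)) = fun k : ℕ =>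
      ((k : ℝ) + 1) ^ 2 * (-r) ^ k - ((k : ℝ) + 1) ^ 2 * (-r') ^ k := by
    ext k; ring
  refine ⟨?_, fun s hs => ?_⟩
  · rw [hrw]
    exact ((hasSum_succ_sq h0 hr1).summable.sub (hasSum_succ_sq hr0 h1).summable).norm
  · obtain ⟨h2, h3⟩ := mul_mem_unit h0 hr1 hs
    obtain ⟨h2', h3'⟩ := mul_mem_unit hr0 h1 hs
    have := ((hasSum_succ_sq h2 h3).sub (hasSum_succ_sq h2' h3')).tsum_eq
    have h4 : pser (fun k => ((k : ℝ) + 1) ^ 2 * ((-r) ^ k - (-r') ^ k)) s =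
        (1 - r * s) / (1 + r * s) ^ 3 - (1 - r' * s) / (1 + r' * s) ^ 3 := by
      rw [← this]
      exact tsum_congr fun k => by rw [← neg_mul r s, ← neg_mul r' s, mul_pow, mul_pow]; ring
    rw [h4, sub_nonneg]
    have hle : r * s ≤ r' * s := mul_le_mul_of_nonneg_right hr hs.1
    have : 0 ≤ 1 - r' * s := by linarith
    gcongr

end RealSeries

/-! ### The solution `q` and the real part estimate -/

section Solution

/-- The coefficients of the solution `q` of the differential equation in `SolvesQ`. -/
noncomputable def solutionCoeff (μ ν : ℝ) (k : ℕ) : ℝ :=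
  kernelCoeff μ ν k * (((k : ℝ) + 1) ^ 2 * (-1) ^ k)

theorem solutionCoeff_mul_pow (μ ν t : ℝ) (k : ℕ) :
    solutionCoeff μ ν k * t ^ k = kernelCoeff μ ν k * (((k : ℝ) + 1) ^ 2 * (-t) ^ k) := by
  rw [solutionCoeff, ← neg_one_mul t, mul_pow]
  ring

theorem kernelCoeff_mem {μ ν : ℝ} (hμ : 0 < μ) (hν : 0 < ν) (k : ℕ) :
    0 ≤ kernelCoeff μ ν k ∧ kernelCoeff μ ν k ≤ 1 := by
  have h1 : 1 ≤ 1 + μ * k := by have : 0 ≤ μ * k := by positivity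
                                linarith
  have h2 : 1 ≤ 1 + ν * k := by have : 0 ≤ ν * k := by positivity
                                linarith
  refine ⟨by unfold kernelCoeff; positivity, ?_⟩
  exact (div_le_one (by positivity)).2 (one_le_mul_of_one_le_of_one_le h1 h2)

theorem unitRadius_solutionCoeff {μ ν : ℝ} (hμ : 0 < μ) (hν : 0 < ν) :
    UnitRadius (solutionCoeff μ ν) := by
  have h : UnitRadius fun k : ℕ => ((1 : ℝ) + 1 * k) * ((1 + 1 * k) * 1) :=
    (UnitRadius.one.affine_mul 1 1).affine_mul 1 1
  refine h.of_norm_le (C := 1) fun k => ?_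
  obtain ⟨h1, h2⟩ := kernelCoeff_mem hμ hν k
  rw [solutionCoeff, norm_mul, norm_mul, norm_pow, norm_pow, Real.norm_of_nonneg h1, norm_neg,
    norm_one, one_pow, mul_one, Real.norm_of_nonneg (by positivity),
    Real.norm_of_nonneg (by positivity)]
  refine mul_le_mul h2 (le_of_eq (by ring)) (by positivity) zero_le_one

/-- Termwise, this is the identity `(1/ν + k) / ((1+μk)(1+νk)) = (1/(μν)) / (k + 1/μ)`. -/
theorem hasDerivAt_solution {μ ν t : ℝ} (hμ : 0 < μ) (hν : 0 < ν) (ht : t ∈ Ioo (0 : ℝ) 1) :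
    HasDerivAt (fun x : ℝ => x ^ (1 / ν) * pser (solutionCoeff μ ν) x)
      (1 / (μ * ν) * t ^ (1 / ν - 1) *
        ∫ s in (0 : ℝ)..1, s ^ (1 / μ - 1) * ((1 - s * t) / (1 + s * t) ^ 3)) t := by
  have hu := unitRadius_solutionCoeff hμ hν
  have htn : ‖t‖ < 1 := by rw [Real.norm_of_nonneg ht.1.le]; exact ht.2
  obtain ⟨d, hd, hd'⟩ := hu.exists_hasDerivAt htn
  refine ((Real.hasDerivAt_rpow_const (Or.inl ht.1.ne')).mul hd).congr_deriv ?_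
  have hint := (hasSum_integral_logWeight (A := 1 / μ) (P := 1) (by positivity) one_pos
    (hasSum_succ_sq ht.1.le ht.2).summable.norm).tsum_eq
  have hI : ∫ s in (0 : ℝ)..1, s ^ (1 / μ - 1) * ((1 - s * t) / (1 + s * t) ^ 3) =
      ∑' k : ℕ, Real.Gamma 1 / (k + 1 / μ) ^ (1 : ℝ) * (((k : ℝ) + 1) ^ 2 * (-t) ^ k) := by
    simp only [RCLike.ofReal_real_eq_id, id] at hint
    rw [hint, intervalIntegral.integral_of_le zero_le_one, integral_Ioc_eq_integral_Ioo]
    refine setIntegral_congr_fun measurableSet_Ioo fun s hs => ?_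
    obtain ⟨h2, h3⟩ := mul_mem_unit ht.1.le ht.2 (Ioo_subset_Icc_self hs)
    have h4 : pser (fun k : ℕ => ((k : ℝ) + 1) ^ 2 * (-t) ^ k) s =
        (1 - s * t) / (1 + s * t) ^ 3 := by
      rw [mul_comm s t, ← (hasSum_succ_sq h2 h3).tsum_eq]
      exact tsum_congr fun k => by rw [← neg_mul t s, mul_pow]; ring
    simp only [h4, logWeight, sub_self, Real.rpow_zero, one_mul]
  have hpow : t ^ (1 / ν) = t ^ (1 / ν - 1) * t := by
    rw [Real.rpow_sub_one ht.1.ne']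
    have := ht.1.ne'
    field_simp
  have haff := pser_affine_mul hu (1 / ν) 1 htn
  rw [hI, hpow, mul_assoc (t ^ (1 / ν - 1)) t d, hd', mul_comm (1 / ν), mul_assoc, ← mul_add,
    mul_comm (1 / (μ * ν)), mul_assoc]
  congr 1
  rw [one_mul] at haff
  rw [← haff, pser, ← tsum_mul_left]
  refine tsum_congr fun k => ?_
  rw [mul_assoc, solutionCoeff_mul_pow, Real.Gamma_one, Real.rpow_one, kernelCoeff]
  field_simp
  ring

theorem SolvesQ.eq_pser {μ ν : ℝ} (hμ : 0 < μ) (hν : 0 < ν) {q : ℝ → ℝ} (hq : SolvesQ μ ν q)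
    {t : ℝ} (ht : t ∈ Ioo (0 : ℝ) 1) : q t = pser (solutionCoeff μ ν) t := by
  have hu := unitRadius_solutionCoeff hμ hν
  set g : ℝ → ℝ := fun x => x ^ (1 / ν) * q x - x ^ (1 / ν) * pser (solutionCoeff μ ν) x with hg
  have hd : ∀ x ∈ Ioo (0 : ℝ) 1, HasDerivAt g 0 x := fun x hx =>
    ((hq.2 x hx).sub (hasDerivAt_solution hμ hν hx)).congr_deriv (sub_self _)
  have hconst : ∀ x ∈ Ioo (0 : ℝ) 1, g x = g t := fun x hx =>
    isOpen_Ioo.is_const_of_deriv_eq_zero isPreconnected_Ioo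
      (fun y hy => (hd y hy).differentiableAt.differentiableWithinAt)
      (fun y hy => (hd y hy).deriv) hx ht
  -- The difference `g` is constant, and `x^{1/ν} → 0` while both solutions have finite limits at
  -- `0`.
  have hlim : Tendsto g (𝓝[>] 0) (𝓝 0) := by
    have h1 : Tendsto (fun x : ℝ => x ^ (1 / ν)) (𝓝[>] 0) (𝓝 0) := by
      have := (Real.continuousAt_rpow_const 0 (1 / ν) (Or.inr (by positivity))).tendsto
      rw [Real.zero_rpow (by positivity)] at this
      exact this.mono_left nhdsWithin_le_nhds
    have h2 : Tendsto (pser (solutionCoeff μ ν)) (𝓝[>] 0) (𝓝 (pser (solutionCoeff μ ν) 0)) :=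
      ((hu.continuousOn 0 (by simp)).continuousAt (Metric.ball_mem_nhds 0 one_pos)).tendsto.mono_left
        nhdsWithin_le_nhds
    have h3 := (h1.mul hq.1).sub (h1.mul h2)
    rwa [zero_mul, zero_mul, sub_zero] at h3
  have hev : g =ᶠ[𝓝[>] 0] fun _ => g t :=
    eventually_of_mem (Ioo_mem_nhdsGT one_pos) hconst
  have h0 : g t = 0 := tendsto_nhds_unique (tendsto_const_nhds.congr' hev.symm) hlim
  have hpos : 0 < t ^ (1 / ν) := Real.rpow_pos_of_pos ht.1 _
  rw [hg] at h0
  exact mul_left_cancel₀ hpos.ne' (sub_eq_zero.1 h0)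

theorem pser_solutionCoeff_nonneg {μ ν t : ℝ} (hμ : 0 < μ) (hν : 0 < ν) (ht : t ∈ Ioo (0 : ℝ) 1) :
    0 ≤ pser (solutionCoeff μ ν) t := by
  simp only [pser, solutionCoeff_mul_pow]
  exact (isPosMultiplier_kernelCoeff hμ hν _ (posOnUnit_succ_sq ht.1.le ht.2)).tsum_nonneg

theorem pser_solutionCoeff_anti {μ ν s t : ℝ} (hμ : 0 < μ) (hν : 0 < ν) (hs : 0 ≤ s)
    (hst : s ≤ t) (ht : t < 1) :
    pser (solutionCoeff μ ν) t ≤ pser (solutionCoeff μ ν) s := by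
  have hu := unitRadius_solutionCoeff hμ hν
  have h := (isPosMultiplier_kernelCoeff hμ hν _ (posOnUnit_succ_sq_sub hs hst ht)).tsum_nonneg
  have hn : ∀ x : ℝ, 0 ≤ x → x < 1 → ‖x‖ < 1 := fun x h0 h1 => by rwa [Real.norm_of_nonneg h0]
  have h2 := ((hu.hasSum (hn s hs (hst.trans_lt ht))).sub
    (hu.hasSum (hn t (hs.trans hst) ht))).tsum_eq
  rw [← sub_nonneg, ← h2]
  refine h.trans_eq (tsum_congr fun k => ?_)
  rw [solutionCoeff_mul_pow, solutionCoeff_mul_pow]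
  ring

theorem komatu_integral_le {μ ν c p r : ℝ} (hμ : 0 < μ) (hν : 0 < ν) (hc : -1 < c) (hp : 0 < p)
    {q : ℝ → ℝ} (hq : SolvesQ μ ν q) (h0 : 0 ≤ r) (h1 : r < 1) :
    (1 + c) ^ p / Real.Gamma p * ∫ t in (0 : ℝ)..1, t ^ c * Real.log (1 / t) ^ (p - 1) * q t ≤
      ∑' k : ℕ, komatuCoeff c p k * (kernelCoeff μ ν k * (((k : ℝ) + 1) ^ 2 * (-r) ^ k)) := by
  have hc' : 0 < c + 1 := by linarith
  have hG := Real.Gamma_pos_of_pos hp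
  have hu := unitRadius_solutionCoeff hμ hν
  set a : ℕ → ℝ := fun k => solutionCoeff μ ν k * r ^ k with ha
  have hsum : Summable fun k => ‖a k‖ :=
    hu.summable_norm (z := r) (by rwa [Real.norm_of_nonneg h0])
  have hpa : ∀ t, pser a t = pser (solutionCoeff μ ν) (r * t) := fun t =>
    tsum_congr fun k => by rw [ha, mul_pow]; ring
  have hint := (hasSum_integral_logWeight hc' hp hsum).tsum_eq
  simp only [RCLike.ofReal_real_eq_id, id, hpa] at hint
  have hle : ∫ t in (0 : ℝ)..1, t ^ c * Real.log (1 / t) ^ (p - 1) * q t ≤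
      ∫ t in Ioo (0 : ℝ) 1, logWeight (c + 1) p t * pser (solutionCoeff μ ν) (r * t) := by
    have hE : ∫ t in (0 : ℝ)..1, t ^ c * Real.log (1 / t) ^ (p - 1) * q t =
        ∫ t in Ioo (0 : ℝ) 1, logWeight (c + 1) p t * pser (solutionCoeff μ ν) t := by
      rw [intervalIntegral.integral_of_le zero_le_one, integral_Ioc_eq_integral_Ioo]
      refine setIntegral_congr_fun measurableSet_Ioo fun t ht => ?_
      simp only [hq.eq_pser hμ hν ht, logWeight, add_sub_cancel_right]
      ring
    rw [hE]
    -- The comparison is `q(t) ≤ q(rt)`. As the smaller integrand is nonnegative, only the larger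
    -- one, continuous up to `t = 1` because `r < 1`, must be shown integrable.
    refine integral_mono_of_nonneg ?_ ?_ ?_
    · exact (ae_restrict_mem measurableSet_Ioo).mono fun t ht =>
        mul_nonneg (logWeight_nonneg _ _ ht) (pser_solutionCoeff_nonneg hμ hν ht)
    · refine (integrableOn_logWeight hc' hp).mul_continuousOn_of_subset (K := Icc 0 1) ?_
        measurableSet_Ioo isCompact_Icc Ioo_subset_Icc_self
      refine hu.continuousOn.comp (by fun_prop) fun t ht => ?_
      obtain ⟨h2, h3⟩ := mul_mem_unit h0 h1 ht
      rwa [mem_ball_zero_iff, Real.norm_of_nonneg h2]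
    · exact (ae_restrict_mem measurableSet_Ioo).mono fun t ht =>
        mul_le_mul_of_nonneg_left (pser_solutionCoeff_anti hμ hν (mul_nonneg h0 ht.1.le)
          (mul_le_of_le_one_left ht.1.le h1.le) ht.2) (logWeight_nonneg _ _ ht)
  refine (mul_le_mul_of_nonneg_left hle
    (div_nonneg (Real.rpow_nonneg (by linarith) p) hG.le)).trans_eq ?_
  rw [← hint, ← tsum_mul_left]
  refine tsum_congr fun k => ?_
  simp only [ha]
  rw [solutionCoeff_mul_pow, komatuCoeff, Real.div_rpow hc'.le (by positivity), add_comm 1 c]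
  field_simp

/-- The real part estimate which makes the convolution with the Pascu kernel positive. -/
theorem le_re_pser {μ ν c p ξ : ℝ} (hμ : 1 ≤ μ) (hν : 0 < ν) (hc1 : -1 < c) (hc0 : c < 0)
    (hp : 2 < p) (hξ0 : 0 ≤ ξ) (hξ1 : ξ ≤ 1) {v z : ℂ} (hv : ‖v‖ = 1) (hz : ‖z‖ < 1)
    (hu : UnitRadius fun k : ℕ => ((komatuCoeff c p k * kernelCoeff μ ν k * (1 + ξ * k) : ℝ) : ℂ) *
      (1 + (1 + v) / 2 * k)) :
    ∑' k : ℕ, komatuCoeff c p k * (kernelCoeff μ ν k * (((k : ℝ) + 1) ^ 2 * (-‖z‖) ^ k)) ≤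
      (pser (fun k : ℕ => ((komatuCoeff c p k * kernelCoeff μ ν k * (1 + ξ * k) : ℝ) : ℂ) *
        (1 + (1 + v) / 2 * k)) z).re := by
  have hμ0 : 0 < μ := by linarith
  have hk := isPosMultiplier_kernelCoeff hμ0 hν
  have hkom := isPosMultiplier_komatuCoeff hc1 (by linarith : 0 < p)
  obtain ⟨m, hm, hmk⟩ := exists_isPosMultiplier_komatuCoeff hc1 hc0 hp
  have hgap := hm _ (posOnUnit_gapCoeff hz hv)
  -- With `1 + ξk = (1-ξ) + ξ(k+1)`, the difference of the two sides splits into these `gapCoeff`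
  -- terms plus `1-ξ` times the multiple of `-k(k+1)(-|z|)^k`, whose generating function is
  -- `2x/(1+x)³ ≥ 0`.
  have h1 := ((((IsPosMultiplier.const (sub_nonneg.2 hξ1)).mul hk).add
    ((IsPosMultiplier.const hξ0).mul (isPosMultiplier_succ_mul_kernelCoeff hμ hν))) _ hgap).add
    (((IsPosMultiplier.const (sub_nonneg.2 hξ1)).mul (hkom.mul hk)) _
      (posOnUnit_mul_succ (norm_nonneg z) hz))
  have h2 := h1.tsum_nonneg
  have h3 := Complex.hasSum_re (hu.hasSum hz)
  have h4 : Summable fun k : ℕ =>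
      komatuCoeff c p k * (kernelCoeff μ ν k * (((k : ℝ) + 1) ^ 2 * (-‖z‖) ^ k)) :=
    summable_abs_iff.1 (hkom _ (hk _ (posOnUnit_succ_sq (norm_nonneg z) hz))).1
  rw [← sub_nonneg, ← (h3.sub h4.hasSum).tsum_eq]
  refine h2.trans_eq (tsum_congr fun k => ?_)
  have h5 : ((komatuCoeff c p k * kernelCoeff μ ν k * (1 + ξ * k) : ℝ) : ℂ) *
        (1 + (1 + v) / 2 * k) * z ^ k =
      ((komatuCoeff c p k * kernelCoeff μ ν k * (1 + ξ * k) : ℝ) : ℂ) *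
        ((1 + (1 + v) / 2 * k) * z ^ k) := by ring
  rw [h5, Complex.re_ofReal_mul, ← mul_assoc (m k), ← hmk, gapCoeff]
  ring

end Solution

/-! ### Hadamard products and half-planes -/

section Convolution

theorem integral_exp_int_mul_I (n : ℤ) :
    ∫ θ in (0 : ℝ)..2 * Real.pi, Complex.exp (n * θ * Complex.I) =
      if n = 0 then 2 * (Real.pi : ℂ) else 0 := by
  split_ifs with h
  · simp [h]
  · have hne : (n : ℂ) * Complex.I ≠ 0 := by simp [h]
    have := integral_exp_mul_complex (a := 0) (b := 2 * Real.pi) hne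
    have h2 : ∀ θ : ℝ, (n : ℂ) * θ * Complex.I = n * Complex.I * θ := fun θ => by ring
    simp only [h2, this]
    have h3 : (n : ℂ) * Complex.I * ((2 * Real.pi : ℝ) : ℂ) = n * (2 * Real.pi * Complex.I) := by
      push_cast; ring
    rw [h3, Complex.exp_int_mul_two_pi_mul_I]
    simp

theorem hasSum_integral_circle {a : ℕ → ℂ} (ha : Summable fun k => ‖a k‖) {h : ℕ → ℝ → ℂ}
    (hc : ∀ k, Continuous (h k)) {M : ℝ} (hM : ∀ k θ, ‖h k θ‖ ≤ M) :
    HasSum (fun k => a k * ∫ θ in (0 : ℝ)..2 * Real.pi, h k θ)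
      (∫ θ in (0 : ℝ)..2 * Real.pi, ∑' k, a k * h k θ) := by
  have hb : ∀ k θ, ‖a k * h k θ‖ ≤ ‖a k‖ * M := fun k θ => by
    rw [norm_mul]
    exact mul_le_mul_of_nonneg_left (hM k θ) (norm_nonneg _)
  have := intervalIntegral.hasSum_integral_of_dominated_convergence (μ := volume)
    (a := 0) (b := 2 * Real.pi) (F := fun k θ => a k * h k θ) (f := fun θ => ∑' k, a k * h k θ)
    (fun k _ => ‖a k‖ * M) (fun k => (continuous_const.mul (hc k)).aestronglyMeasurable)
    (fun k => ae_of_all _ fun θ _ => hb k θ) (ae_of_all _ fun θ _ => ha.mul_right M)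
    intervalIntegrable_const
    (ae_of_all _ fun θ _ => (Summable.of_norm_bounded (ha.mul_right M) fun k => hb k θ).hasSum)
  simpa only [intervalIntegral.integral_const_mul] using this

/-- The point of argument `θ` on the unit circle. -/
noncomputable def circlePt (θ : ℝ) : ℂ := Complex.exp (θ * Complex.I)

theorem norm_circlePt (θ : ℝ) : ‖circlePt θ‖ = 1 := Complex.norm_exp_ofReal_mul_I θ

theorem continuous_circlePt : Continuous circlePt := by
  unfold circlePt
  fun_prop

theorem circlePt_ne_zero (θ : ℝ) : circlePt θ ≠ 0 := Complex.exp_ne_zero _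

theorem circlePt_zpow (θ : ℝ) (n : ℤ) : circlePt θ ^ n = Complex.exp (n * θ * Complex.I) := by
  rw [circlePt, ← Complex.exp_int_mul, mul_assoc]

theorem norm_mul_circlePt (z : ℂ) (θ : ℝ) : ‖z * circlePt θ‖ = ‖z‖ := by
  rw [norm_mul, norm_circlePt, mul_one]

theorem UnitRadius.continuous_circle {u : ℕ → ℂ} (hu : UnitRadius u) {z : ℂ} (hz : ‖z‖ < 1) :
    Continuous fun θ => pser u (z * circlePt θ) :=
  hu.continuousOn.comp_continuous (continuous_const.mul continuous_circlePt) fun θ => by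
    rwa [mem_ball_zero_iff, norm_mul_circlePt]

theorem integral_pser_mul_zpow {u : ℕ → ℂ} (hu : UnitRadius u) {z : ℂ} (hz : ‖z‖ < 1) (n : ℤ) :
    ∫ θ in (0 : ℝ)..2 * Real.pi, pser u (z * circlePt θ) * circlePt θ ^ n =
      ∑' k : ℕ, u k * z ^ k * if (k : ℤ) + n = 0 then 2 * (Real.pi : ℂ) else 0 := by
  have h := (hasSum_integral_circle (hu.summable_norm hz)
    (h := fun k θ => circlePt θ ^ ((k : ℤ) + n))
    (fun k => continuous_circlePt.zpow₀ _ fun θ => Or.inl (circlePt_ne_zero θ)) (M := 1)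
    (fun k θ => by rw [norm_zpow, norm_circlePt, one_zpow])).tsum_eq
  have h1 : ∀ k : ℕ, ∫ θ in (0 : ℝ)..2 * Real.pi, circlePt θ ^ ((k : ℤ) + n) =
      if (k : ℤ) + n = 0 then 2 * (Real.pi : ℂ) else 0 := fun k => by
    rw [← integral_exp_int_mul_I]
    simp only [circlePt_zpow]
  simp only [h1] at h
  rw [h]
  refine intervalIntegral.integral_congr fun θ _ => ?_
  simp only [pser]
  rw [← tsum_mul_right]
  refine tsum_congr fun k => ?_
  rw [zpow_add₀ (circlePt_ne_zero θ), zpow_natCast, mul_pow]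
  ring

theorem integral_pser_mul_zpow_neg {u : ℕ → ℂ} (hu : UnitRadius u) {z : ℂ} (hz : ‖z‖ < 1)
    (n : ℕ) :
    ∫ θ in (0 : ℝ)..2 * Real.pi, pser u (z * circlePt θ) * circlePt θ ^ (-(n : ℤ)) =
      2 * Real.pi * (u n * z ^ n) := by
  rw [integral_pser_mul_zpow hu hz, tsum_eq_single n]
  · simp [mul_comm]
  · intro k hk
    rw [if_neg (by omega), mul_zero]

theorem integral_pser_mul_pow {u : ℕ → ℂ} (hu : UnitRadius u) {z : ℂ} (hz : ‖z‖ < 1)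
    (n : ℕ) :
    ∫ θ in (0 : ℝ)..2 * Real.pi, pser u (z * circlePt θ) * circlePt θ ^ (n : ℤ) =
      if n = 0 then 2 * Real.pi * u 0 else 0 := by
  rw [integral_pser_mul_zpow hu hz, tsum_eq_single 0]
  · simp [mul_comm]
  · intro k hk
    rw [if_neg (by omega), mul_zero]

/-- The Hadamard product as a mean over a circle. -/
theorem integral_pser_mul_poisson {u g : ℕ → ℂ} (hu : UnitRadius u) (hg : UnitRadius g)
    (hg0 : g 0 = 1) {x y : ℂ} (hx : ‖x‖ < 1) (hy : ‖y‖ < 1) :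
    ∫ θ in (0 : ℝ)..2 * Real.pi, pser u (x * circlePt θ) *
        ((2 * (pser g (y * circlePt (-θ))).re - 1 : ℝ) : ℂ) =
      2 * Real.pi * pser (fun k => u k * g k) (x * y) := by
  have hcu := hu.continuous_circle hx
  have hM : ∀ θ, ‖pser u (x * circlePt θ)‖ ≤ ∑' k, ‖u k * x ^ k‖ := fun θ => by
    have h1 : ∀ k, ‖u k * (x * circlePt θ) ^ k‖ = ‖u k * x ^ k‖ := fun k => by
      rw [norm_mul, norm_mul, norm_pow, norm_pow, norm_mul_circlePt]
    have h2 : Summable fun k => ‖u k * (x * circlePt θ) ^ k‖ := by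
      simpa only [h1] using hu.summable_norm hx
    have h3 := norm_tsum_le_tsum_norm h2
    simp only [h1] at h3
    exact h3
  have hz : ∀ (n : ℤ) θ, ‖pser u (x * circlePt θ) * circlePt θ ^ n‖ ≤ ∑' k, ‖u k * x ^ k‖ :=
    fun n θ => by
      rw [norm_mul, norm_zpow, norm_circlePt, one_zpow, mul_one]
      exact hM θ
  have hzc : ∀ n : ℤ, Continuous fun θ => pser u (x * circlePt θ) * circlePt θ ^ n := fun n =>
    hcu.mul (continuous_circlePt.zpow₀ _ fun θ => Or.inl (circlePt_ne_zero θ))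
  have hneg : ∀ θ, circlePt (-θ) = (circlePt θ)⁻¹ := fun θ => by
    rw [circlePt, circlePt, ← Complex.exp_neg]
    congr 1
    push_cast
    ring
  have hconj : ∀ θ, (starRingEnd ℂ) (circlePt (-θ)) = circlePt θ := fun θ => by
    rw [circlePt, circlePt, ← Complex.exp_conj]
    congr 1
    simp
  have hs := hg.summable_norm hy
  have hs' : Summable fun k => ‖(starRingEnd ℂ) (g k * y ^ k)‖ := by
    simpa only [RCLike.norm_conj] using hs
  have h1 := hasSum_integral_circle hs (fun k => hzc (-(k : ℤ))) fun k => hz _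
  have h2 := hasSum_integral_circle hs' (fun k => hzc (k : ℤ)) fun k => hz _
  simp only [integral_pser_mul_zpow_neg hu hx] at h1
  simp only [integral_pser_mul_pow hu hx] at h2
  have e1 : ∀ θ, ∑' k, g k * y ^ k * (pser u (x * circlePt θ) * circlePt θ ^ (-(k : ℤ))) =
      pser u (x * circlePt θ) * pser g (y * circlePt (-θ)) := fun θ => by
    rw [pser.eq_1 g, ← tsum_mul_left]
    refine tsum_congr fun k => ?_
    rw [mul_pow, hneg, inv_pow, zpow_neg, zpow_natCast]
    ring
  have e2 : ∀ θ, ∑' k, (starRingEnd ℂ) (g k * y ^ k) *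
      (pser u (x * circlePt θ) * circlePt θ ^ (k : ℤ)) =
      pser u (x * circlePt θ) * (starRingEnd ℂ) (pser g (y * circlePt (-θ))) := fun θ => by
    rw [pser.eq_1 g, Complex.conj_tsum, ← tsum_mul_left]
    refine tsum_congr fun k => ?_
    rw [← mul_assoc, mul_pow, ← mul_assoc (g k), map_mul _ (g k * y ^ k), map_pow, hconj,
      zpow_natCast]
    ring
  simp only [e1] at h1
  simp only [e2] at h2
  have hcg : Continuous fun θ => pser g (y * circlePt (-θ)) :=
    (hg.continuous_circle hy).comp continuous_neg
  have h3 : ∫ θ in (0 : ℝ)..2 * Real.pi, pser u (x * circlePt θ) = 2 * Real.pi * u 0 := by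
    simpa using integral_pser_mul_pow hu hx 0
  have e3 : ∀ θ, pser u (x * circlePt θ) *
      ((2 * (pser g (y * circlePt (-θ))).re - 1 : ℝ) : ℂ) =
      pser u (x * circlePt θ) * pser g (y * circlePt (-θ)) +
      pser u (x * circlePt θ) * (starRingEnd ℂ) (pser g (y * circlePt (-θ))) -
      pser u (x * circlePt θ) := fun θ => by
    have := Complex.add_conj (pser g (y * circlePt (-θ)))
    push_cast at this ⊢
    rw [← this]
    ring
  have i1 : IntervalIntegrable (fun θ => pser u (x * circlePt θ) * pser g (y * circlePt (-θ)))
      volume 0 (2 * Real.pi) := (hcu.mul hcg).intervalIntegrable _ _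
  have i2 : IntervalIntegrable (fun θ => pser u (x * circlePt θ) *
      (starRingEnd ℂ) (pser g (y * circlePt (-θ)))) volume 0 (2 * Real.pi) :=
    (hcu.mul (Complex.continuous_conj.comp hcg)).intervalIntegrable _ _
  simp only [e3]
  -- The conjugate series brings only nonnegative powers of `circlePt θ`, so just its constant term
  -- survives, and the `-1` in the weight cancels it because `g 0 = 1`.
  rw [intervalIntegral.integral_sub (i1.add i2) (hcu.intervalIntegrable _ _),
    intervalIntegral.integral_add i1 i2, ← h1.tsum_eq, ← h2.tsum_eq, h3,
    tsum_eq_single (f := fun k : ℕ => (starRingEnd ℂ) (g k * y ^ k) * _) 0]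
  · simp only [if_true, hg0, pow_zero, one_mul, map_one, add_sub_cancel_right]
    rw [pser, ← tsum_mul_left]
    refine tsum_congr fun k => ?_
    rw [mul_pow]
    ring
  · intro k hk
    rw [if_neg hk, mul_zero]

theorem re_pser_mul_pos {u g : ℕ → ℂ} (hu : UnitRadius u) (hg : UnitRadius g) (hg0 : g 0 = 1)
    {ω : ℂ} (hpos : ∀ z : ℂ, ‖z‖ < 1 → 0 < (ω * pser u z).re)
    (hre : ∀ z : ℂ, ‖z‖ < 1 → 1 / 2 ≤ (pser g z).re) {z : ℂ} (hz : ‖z‖ < 1) :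
    0 < (ω * pser (fun k => u k * g k) z).re := by
  obtain ⟨ρ, hzρ, hρ⟩ := exists_between hz
  have hρ0 : 0 < ρ := (norm_nonneg z).trans_lt hzρ
  -- Writing `z = ρ y` puts both factors inside the open disc, as the circle mean requires.
  set y : ℂ := z / ρ with hydef
  have hρn : ‖(ρ : ℂ)‖ = ρ := by rw [Complex.norm_real, Real.norm_of_nonneg hρ0.le]
  have hx : ‖(ρ : ℂ)‖ < 1 := by rwa [hρn]
  have hy : ‖y‖ < 1 := by
    rw [hydef, norm_div, hρn]
    exact (div_lt_one hρ0).2 hzρ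
  have hxy : (ρ : ℂ) * y = z := mul_div_cancel₀ z (by exact_mod_cast hρ0.ne')
  set W : ℝ → ℝ := fun θ => 2 * (pser g (y * circlePt (-θ))).re - 1 with hW
  have hWc : Continuous W := by
    have : Continuous fun θ => pser g (y * circlePt (-θ)) :=
      (hg.continuous_circle hy).comp continuous_neg
    exact (continuous_const.mul (Complex.continuous_re.comp this)).sub continuous_const
  have hW0 : ∀ θ, 0 ≤ W θ := fun θ => by
    have := hre (y * circlePt (-θ)) (by rwa [norm_mul_circlePt])
    simp only [hW]
    linarith
  -- The total mass of the weight is the same mean formula applied to the constant series `1`.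
  have hWint : ∫ θ in (0 : ℝ)..2 * Real.pi, W θ = 2 * Real.pi := by
    have hone : UnitRadius fun k : ℕ => if k = 0 then (1 : ℂ) else 0 := UnitRadius.single 1
    have hp := pser_single (1 : ℂ)
    have hp' : pser (fun k : ℕ => (if k = 0 then (1 : ℂ) else 0) * g k) (0 * y) = 1 := by
      rw [zero_mul, pser_zero]
      simp [hg0]
    have := integral_pser_mul_poisson hone hg hg0 (x := 0) (by simp) hy
    rw [hp'] at this
    simp only [hp, one_mul, mul_one] at this
    rw [intervalIntegral.integral_ofReal] at this
    exact_mod_cast this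
  have hUc : Continuous fun θ => (ω * pser u (ρ * circlePt θ)).re :=
    Complex.continuous_re.comp (continuous_const.mul (hu.continuous_circle hx))
  obtain ⟨m, hm0, hm⟩ : ∃ m : ℝ, 0 < m ∧ ∀ θ ∈ Icc (0 : ℝ) (2 * Real.pi),
      m ≤ (ω * pser u (ρ * circlePt θ)).re := by
    obtain ⟨θ₀, -, hθ⟩ := isCompact_Icc.exists_isMinOn
      (nonempty_Icc.2 Real.two_pi_pos.le) hUc.continuousOn
    exact ⟨_, hpos (ρ * circlePt θ₀) (by rwa [norm_mul_circlePt]), fun θ hθ' => hθ hθ'⟩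
  have key := congrArg (fun w : ℂ => (ω * w).re)
    (integral_pser_mul_poisson hu hg hg0 hx hy)
  simp only [hxy] at key
  rw [← intervalIntegral.integral_const_mul] at key
  have hcont : Continuous fun θ => ω * (pser u (ρ * circlePt θ) * ((W θ : ℝ) : ℂ)) :=
    continuous_const.mul ((hu.continuous_circle hx).mul (Complex.continuous_ofReal.comp hWc))
  have hre2 : (∫ θ in (0 : ℝ)..2 * Real.pi, ω * (pser u (ρ * circlePt θ) * ((W θ : ℝ) : ℂ))).re =
      ∫ θ in (0 : ℝ)..2 * Real.pi, (ω * pser u (ρ * circlePt θ)).re * W θ := by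
    have h := Complex.reCLM.intervalIntegral_comp_comm
      (hcont.intervalIntegrable (μ := volume) 0 (2 * Real.pi))
    simp only [Complex.reCLM_apply] at h
    rw [← h]
    refine intervalIntegral.integral_congr fun θ _ => ?_
    simp only [← mul_assoc]
    rw [Complex.re_mul_ofReal]
  rw [hre2] at key
  have hlow : ∫ θ in (0 : ℝ)..2 * Real.pi, m * W θ ≤
      ∫ θ in (0 : ℝ)..2 * Real.pi, (ω * pser u (ρ * circlePt θ)).re * W θ :=
    intervalIntegral.integral_mono_on Real.two_pi_pos.le
      (Continuous.intervalIntegrable (by fun_prop) _ _)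
      (Continuous.intervalIntegrable (by fun_prop) _ _)
      fun θ hθ => mul_le_mul_of_nonneg_right (hm θ hθ) (hW0 θ)
  rw [intervalIntegral.integral_const_mul, hWint] at hlow
  have h4 : (ω * (2 * Real.pi * pser (fun k => u k * g k) z)).re =
      2 * Real.pi * (ω * pser (fun k => u k * g k) z).re := by
    rw [mul_left_comm]
    have : (2 * (Real.pi : ℂ)) = ((2 * Real.pi : ℝ) : ℂ) := by push_cast; ring
    rw [this, Complex.re_ofReal_mul]
  rw [h4] at key
  have h5 : 0 < 2 * Real.pi * (ω * pser (fun k => u k * g k) z).re := by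
    rw [← key]
    exact (mul_pos hm0 Real.two_pi_pos).trans_le hlow
  exact pos_of_mul_pos_right h5 Real.two_pi_pos.le

end Convolution

/-! ### Translating the function classes into coefficients -/

section Classes

theorem komatuCoeff_mem {c p : ℝ} (hc : -1 < c) (hp : 0 ≤ p) (k : ℕ) :
    0 ≤ komatuCoeff c p k ∧ komatuCoeff c p k ≤ 1 := by
  have hc' : 0 < c + 1 := by linarith
  refine ⟨by unfold komatuCoeff; positivity, Real.rpow_le_one (by positivity) ?_ hp⟩
  exact (div_le_one (by positivity)).2 (by linarith [k.cast_nonneg (α := ℝ)])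

theorem UnitRadius.komatuCoeff_mul {a : ℕ → ℂ} (ha : UnitRadius a) {c p : ℝ} (hc : -1 < c)
    (hp : 0 ≤ p) : UnitRadius fun k => (komatuCoeff c p k : ℂ) * a k :=
  ha.of_norm_le (C := 1) fun k => by
    obtain ⟨h0, h1⟩ := komatuCoeff_mem hc hp k
    rw [norm_mul, Complex.norm_real, Real.norm_of_nonneg h0]
    exact mul_le_mul_of_nonneg_right h1 (norm_nonneg _)

/-- The Komatu operator acts on power series by multiplication of the coefficients. -/
theorem komatu_eq_mul_pser {c p : ℝ} (hc : -1 < c) (hp : 0 < p) {a : ℕ → ℂ} (ha : UnitRadius a)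
    {f : ℂ → ℂ} (hf : ∀ z ∈ Metric.ball (0 : ℂ) 1, f z = z * pser a z) {z : ℂ}
    (hz : z ∈ Metric.ball (0 : ℂ) 1) :
    komatu c p f z = z * pser (fun k => (komatuCoeff c p k : ℂ) * a k) z := by
  have hz' := mem_ball_zero_iff.1 hz
  have hc' : 0 < c + 1 := by linarith
  have hG := Real.Gamma_pos_of_pos hp
  have hint : HasSum
      (fun k : ℕ => ((Real.Gamma p / (k + (c + 1)) ^ p : ℝ) : ℂ) * (a k * z ^ k))
      (∫ t in Ioo (0 : ℝ) 1, (logWeight (c + 1) p t : ℂ) * pser (fun k => a k * z ^ k) (t : ℂ)) :=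
    hasSum_integral_logWeight hc' hp (ha.summable_norm hz')
  have hI : ∫ t in (0 : ℝ)..1, ((Real.log (1 / t) ^ (p - 1) * t ^ (c - 1) : ℝ) : ℂ) * f (t * z) =
      z * ∫ t in Ioo (0 : ℝ) 1,
        (logWeight (c + 1) p t : ℂ) * pser (fun k => a k * z ^ k) (t : ℂ) := by
    rw [intervalIntegral.integral_of_le zero_le_one, integral_Ioc_eq_integral_Ioo,
      ← integral_const_mul]
    refine setIntegral_congr_fun measurableSet_Ioo fun t ht => ?_
    have htz : (t : ℂ) * z ∈ Metric.ball (0 : ℂ) 1 := by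
      rw [mem_ball_zero_iff, norm_mul, Complex.norm_real, Real.norm_of_nonneg ht.1.le]
      exact (mul_le_of_le_one_left (norm_nonneg z) ht.2.le).trans_lt hz'
    have h1 : pser a (t * z) = pser (fun k => a k * z ^ k) (t : ℂ) :=
      tsum_congr fun k => by rw [mul_pow]; ring
    have h2 : logWeight (c + 1) p t = Real.log (1 / t) ^ (p - 1) * t ^ (c - 1) * t := by
      rw [logWeight, add_sub_cancel_right, Real.rpow_sub_one ht.1.ne', mul_assoc,
        div_mul_cancel₀ _ ht.1.ne']
    simp only [hf _ htz, h1, h2]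
    push_cast
    ring
  rw [komatu, hI, mul_left_comm, ← hint.tsum_eq, ← tsum_mul_left]
  congr 1
  refine tsum_congr fun k => ?_
  rw [← mul_assoc, ← Complex.ofReal_mul, ← mul_assoc]
  congr 3
  rw [komatuCoeff, Real.div_rpow hc'.le (by positivity)]
  field_simp

/-- Expanding `dslope f 0` rather than `f` makes the indexing start at the normalized coefficient
`1` and covers `z = 0`. -/
theorem ClassA.exists_pser {f : ℂ → ℂ} (hf : ClassA f) :
    ∃ a : ℕ → ℂ, UnitRadius a ∧ a 0 = 1 ∧
      (∀ z ∈ Metric.ball (0 : ℂ) 1, dslope f 0 z = pser a z) ∧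
      ∀ z ∈ Metric.ball (0 : ℂ) 1, f z = z * pser a z := by
  obtain ⟨hA, h0, h1⟩ := hf
  have hball : Metric.ball (0 : ℂ) 1 ∈ 𝓝 (0 : ℂ) := Metric.ball_mem_nhds 0 one_pos
  obtain ⟨a, ha, hav⟩ := exists_pser_of_analyticOnNhd
    (((Complex.differentiableOn_dslope hball).2 hA.differentiableOn).analyticOnNhd
      Metric.isOpen_ball)
  refine ⟨a, ha, ?_, hav, fun z hz => ?_⟩
  · rw [← pser_zero a, ← hav 0 (by simp), dslope_same, h1]
  · rw [← hav z hz]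
    have := sub_smul_dslope f 0 z
    rw [sub_zero, h0, sub_zero, smul_eq_mul] at this
    exact this.symm

theorem classW_expression {α β γ μ ν : ℝ} (hsum : μ + ν = α - γ) (hprod : μ * ν = γ)
    {f : ℂ → ℂ} {a : ℕ → ℂ} (ha : UnitRadius a)
    (hd : ∀ z ∈ Metric.ball (0 : ℂ) 1, dslope f 0 z = pser a z)
    (hf : ∀ z ∈ Metric.ball (0 : ℂ) 1, f z = z * pser a z) {z : ℂ}
    (hz : z ∈ Metric.ball (0 : ℂ) 1) :
    (1 - α + 2 * γ) * dslope f 0 z + (α - 2 * γ) * deriv f z + γ * z * deriv (deriv f) z - β =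
      pser (fun k => (1 + μ * k) * ((1 + ν * k) * a k) + if k = 0 then -(β : ℂ) else 0) z := by
  have hz' := mem_ball_zero_iff.1 hz
  have ha1 : UnitRadius fun k : ℕ => ((1 : ℂ) + k) * a k := by
    simpa only [one_mul] using ha.affine_mul 1 1
  obtain ⟨d, hd2, hd2'⟩ := ha1.exists_hasDerivAt hz'
  have hdd : deriv (deriv f) z = d := by
    have h1 : deriv f =ᶠ[𝓝 z] pser fun k => (1 + k) * a k :=
      eventually_of_mem (Metric.isOpen_ball.mem_nhds hz) fun w hw => ha.deriv_of_eqOn hf hw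
    rw [h1.deriv_eq, hd2.deriv]
  have e1 := pser_affine_mul ha 1 1 hz'
  have e2 := pser_affine_mul ha.nat_mul 1 1 hz'
  simp only [one_mul] at e1 e2
  have e3 : pser (fun k : ℕ => (k : ℂ) * ((1 + k) * a k)) z =
      pser (fun k : ℕ => (1 + (k : ℂ)) * (k * a k)) z := by
    congr 1; ext k; ring
  have e4 := pser_affine_mul (ha.affine_mul 1 (ν : ℂ)) 1 (μ : ℂ) hz'
  have e5 := pser_affine_mul ha 1 (ν : ℂ) hz'
  have e6 := pser_affine_mul ha.nat_mul 1 (ν : ℂ) hz'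
  have e7 : pser (fun k : ℕ => (k : ℂ) * ((1 + ν * k) * a k)) z =
      pser (fun k : ℕ => (1 + ν * (k : ℂ)) * (k * a k)) z := by
    congr 1; ext k; ring
  rw [pser_add ((ha.affine_mul 1 (ν : ℂ)).affine_mul 1 (μ : ℂ)) (UnitRadius.single _) hz',
    pser_single, e4, e5, e7, e6, hd z hz, ha.deriv_of_eqOn hf hz, hdd, mul_assoc, hd2', e3, e1, e2]
  have hs : (μ : ℂ) + ν = α - γ := by exact_mod_cast hsum
  have hp : (μ : ℂ) * ν = γ := by exact_mod_cast hprod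
  linear_combination (-pser (fun k : ℕ => (k : ℂ) * a k) z) * hs -
    pser (fun k : ℕ => (k : ℂ) * (k * a k)) z * hp

/-- The Hadamard product of the image under the Komatu operator with the Pascu kernel has
no zero. -/
theorem pser_pascu_ne_zero {α β γ μ ν ξ c p : ℝ} (hμ : 1 ≤ μ) (hν : 0 < ν)
    (hsum : μ + ν = α - γ) (hprod : μ * ν = γ) (hc1 : -1 < c) (hc0 : c < 0) (hp : 2 < p)
    (hξ0 : 0 ≤ ξ) (hξ1 : ξ ≤ 1) (hβ : β < 1) {q : ℝ → ℝ} (hq : SolvesQ μ ν q)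
    (hβq : (β - 1 / 2) / (1 - β) =
      -((1 + c) ^ p / Real.Gamma p *
        ∫ t in (0 : ℝ)..1, t ^ c * Real.log (1 / t) ^ (p - 1) * q t))
    {f : ℂ → ℂ} (hW : ClassW α β γ f) {a : ℕ → ℂ} (ha : UnitRadius a) (ha0 : a 0 = 1)
    (hd : ∀ z ∈ Metric.ball (0 : ℂ) 1, dslope f 0 z = pser a z)
    (hf : ∀ z ∈ Metric.ball (0 : ℂ) 1, f z = z * pser a z) {v z : ℂ} (hv : ‖v‖ = 1)
    (hz : ‖z‖ < 1) :
    pser (fun k => (1 + (1 + v) / 2 * k) * ((1 + ξ * k) * (komatuCoeff c p k * a k))) z ≠ 0 := by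
  obtain ⟨-, φ, hφ⟩ := hW
  have hμ0 : 0 < μ := by linarith
  have hp0 : 0 < p := by linarith
  have hβ0 : 0 < 1 - β := by linarith
  set g : ℕ → ℂ := fun k => ((komatuCoeff c p k * kernelCoeff μ ν k * (1 + ξ * k) : ℝ) : ℂ) *
    (1 + (1 + v) / 2 * k) with hgdef
  have hg : UnitRadius g := by
    have h1 : UnitRadius fun k : ℕ => (1 + (1 + v) / 2 * k) * ((1 + (ξ : ℂ) * k) * (1 : ℂ)) :=
      (UnitRadius.one.affine_mul 1 (ξ : ℂ)).affine_mul 1 _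
    refine h1.of_norm_le (C := 1) fun k => ?_
    obtain ⟨h2, h3⟩ := komatuCoeff_mem hc1 hp0.le k
    obtain ⟨h4, h5⟩ := kernelCoeff_mem hμ0 hν k
    have h6 : g k = ((komatuCoeff c p k * kernelCoeff μ ν k : ℝ) : ℂ) *
        ((1 + (1 + v) / 2 * k) * ((1 + (ξ : ℂ) * k) * (1 : ℂ))) := by
      rw [hgdef]; push_cast; ring
    rw [h6, norm_mul, Complex.norm_real, Real.norm_of_nonneg (mul_nonneg h2 h4)]
    exact mul_le_mul_of_nonneg_right (mul_le_one₀ h3 h4 h5) (norm_nonneg _)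
  have hc' : c + 1 ≠ 0 := by linarith
  have hg0 : g 0 = 1 := by
    simp [hgdef, komatuCoeff, kernelCoeff, hc']
  -- With this normalization `G 0 = 1`, the product `U k * G k` is `1 - β` times the target
  -- coefficient for every `k`, and `Re G ≥ 1/2` means `Re g ≥ (1/2 - β)/(1 - β)`, the value fixed
  -- by the equation for `β`.
  set G : ℕ → ℂ := fun k => ((1 - β : ℝ) : ℂ) * g k + if k = 0 then (β : ℂ) else 0 with hGdef
  have hG : UnitRadius G := (hg.const_mul _).add (UnitRadius.single _)
  have hG0 : G 0 = 1 := by simp [hGdef, hg0]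
  have hGre : ∀ w : ℂ, ‖w‖ < 1 → 1 / 2 ≤ (pser G w).re := by
    intro w hw
    have h1 := (komatu_integral_le hμ0 hν hc1 hp0 hq (norm_nonneg w) hw).trans
      (le_re_pser hμ hν hc1 hc0 hp hξ0 hξ1 hv hw hg)
    rw [hGdef, pser_add (hg.const_mul _) (UnitRadius.single _) hw, pser_const_mul, pser_single,
      Complex.add_re, Complex.re_ofReal_mul, Complex.ofReal_re]
    have h2 := mul_le_mul_of_nonneg_left h1 hβ0.le
    have h3 : (1 - β) * ((1 + c) ^ p / Real.Gamma p *
        ∫ t in (0 : ℝ)..1, t ^ c * Real.log (1 / t) ^ (p - 1) * q t) = 1 / 2 - β := by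
      rw [← neg_eq_iff_eq_neg] at hβq
      rw [← hβq]
      field_simp
      ring
    rw [h3] at h2
    linarith
  set U : ℕ → ℂ := fun k => (1 + μ * k) * ((1 + ν * k) * a k) + if k = 0 then -(β : ℂ) else 0
    with hUdef
  have hU : UnitRadius U :=
    ((ha.affine_mul 1 (ν : ℂ)).affine_mul 1 (μ : ℂ)).add (UnitRadius.single _)
  have hpos : ∀ w : ℂ, ‖w‖ < 1 → 0 < (Complex.exp (φ * Complex.I) * pser U w).re := by
    intro w hw
    have h := hφ w (mem_ball_zero_iff.2 hw)
    rwa [classW_expression hsum hprod ha hd hf (mem_ball_zero_iff.2 hw)] at h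
  have key := re_pser_mul_pos hU hG hG0 hpos hGre hz
  have hprodEq : (fun k => U k * G k) = fun k : ℕ => ((1 - β : ℝ) : ℂ) *
      ((1 + (1 + v) / 2 * k) * ((1 + ξ * k) * (komatuCoeff c p k * a k))) := by
    ext k
    rcases eq_or_ne k 0 with rfl | hk
    · simp [hUdef, hG0, ha0, komatuCoeff, hc']
      ring
    · have h1 : ((1 + μ * k) * (1 + ν * k) * kernelCoeff μ ν k : ℂ) = 1 := by
        have h2 : (1 + μ * k) * (1 + ν * k) * kernelCoeff μ ν k = 1 := by
          rw [kernelCoeff]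
          exact mul_one_div_cancel (by positivity)
        exact_mod_cast h2
      simp only [hUdef, hGdef, hgdef, if_neg hk, add_zero]
      push_cast
      linear_combination ((1 - β) * (1 + (1 + v) / 2 * k) * (1 + ξ * k) * komatuCoeff c p k * a k)
        * h1
  rw [hprodEq, pser_const_mul] at key
  intro h0
  rw [h0] at key
  simp at key

/-- A power series whose products with `1 + w k`, `|w - 1 / 2| = 1 / 2`, have no zeros is
starlike. -/
theorem starlike_of_pser_ne_zero {g : ℕ → ℂ} (hg : UnitRadius g)
    (h : ∀ v z : ℂ, ‖v‖ = 1 → ‖z‖ < 1 → pser (fun k => (1 + (1 + v) / 2 * k) * g k) z ≠ 0)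
    {z : ℂ} (hz : ‖z‖ < 1) :
    pser g z ≠ 0 ∧ 0 < (1 + pser (fun k => k * g k) z / pser g z).re := by
  have hexp : ∀ v z : ℂ, ‖v‖ = 1 → ‖z‖ < 1 →
      pser g z + (1 + v) / 2 * pser (fun k => k * g k) z ≠ 0 := by
    intro v z hv hz
    have := h v z hv hz
    rwa [pser_affine_mul hg _ _ hz, one_mul] at this
  have hne : ∀ z : ℂ, ‖z‖ < 1 → pser g z ≠ 0 := fun z hz => by
    have := hexp (-1) z (by simp) hz
    simpa using this
  refine ⟨hne z hz, ?_⟩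
  set P : ℂ → ℝ := fun z => (1 + pser (fun k => k * g k) z / pser g z).re with hP
  have hPc : ContinuousOn P (Metric.ball 0 1) :=
    Complex.continuous_re.comp_continuousOn (continuousOn_const.add
      (hg.nat_mul.continuousOn.div hg.continuousOn fun w hw => hne w (mem_ball_zero_iff.1 hw)))
  have hP0 : P 0 = 1 := by
    simp [hP, pser_zero]
  have hPne : ∀ z : ℂ, ‖z‖ < 1 → P z ≠ 0 := by
    intro z hz h0
    set s := pser (fun k => k * g k) z / pser g z with hs
    set τ := s.im with hτ
    have hsval : s = -1 + τ * Complex.I := by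
      apply Complex.ext
      · have : 1 + s.re = 0 := by simpa [hP] using h0
        simp
        linarith
      · simp [hτ]
    have hden : (1 : ℂ) - τ * Complex.I ≠ 0 := fun h => by
      have := congrArg Complex.re h
      simp at this
    -- For this `v`, `(1+v)/2 = 1/(1 - iτ) = -1/s`, which would produce a zero. Hence `P` never
    -- vanishes, and `P 0 = 1` with connectedness of the disc gives its sign.
    have hnorm : ‖(1 + τ * Complex.I) / (1 - τ * Complex.I)‖ = 1 := by
      have h1 : (1 : ℂ) - τ * Complex.I = (starRingEnd ℂ) (1 + τ * Complex.I) := by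
        simp [sub_eq_add_neg]
      rw [norm_div, h1, RCLike.norm_conj, div_self]
      rw [← RCLike.norm_conj, ← h1]
      exact norm_ne_zero_iff.2 hden
    refine hexp _ z hnorm hz ?_
    have h2 : pser (fun k => k * g k) z = s * pser g z := (div_mul_cancel₀ _ (hne z hz)).symm
    rw [h2, hsval]
    field_simp
    ring
  by_contra hcon
  have hpre : IsPreconnected (Metric.ball (0 : ℂ) 1) := (convex_ball 0 1).isPreconnected
  obtain ⟨w, hw, hw0⟩ := hpre.intermediate_value (mem_ball_zero_iff.2 hz)
    (Metric.mem_ball_self one_pos) hPc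
    (show (0 : ℝ) ∈ Icc (P z) (P 0) from ⟨not_lt.1 hcon, by rw [hP0]; exact zero_le_one⟩)
  exact hPne w (mem_ball_zero_iff.1 hw) hw0

/-- The Pascu denominator is `z g(z)` with `g(z) = ∑ (1 + ξk) b_k z^k`, and the numerator is `z
(zg)'`; hence the quotient is `1 + z g'/g` for `z ≠ 0`. -/
theorem classM_of_pser {ξ : ℝ} {F : ℂ → ℂ} {b : ℕ → ℂ} (hb : UnitRadius b) (hb0 : b 0 = 1)
    (hF : ∀ z ∈ Metric.ball (0 : ℂ) 1, F z = z * pser b z)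
    (h : ∀ v z : ℂ, ‖v‖ = 1 → ‖z‖ < 1 →
      pser (fun k => (1 + (1 + v) / 2 * k) * ((1 + ξ * k) * b k)) z ≠ 0) :
    ClassM ξ F := by
  have hmem0 : (0 : ℂ) ∈ Metric.ball (0 : ℂ) 1 := by simp
  have hb1 : UnitRadius fun k : ℕ => ((1 : ℂ) + k) * b k := by
    simpa only [one_mul] using hb.affine_mul 1 1
  have hg : UnitRadius fun k : ℕ => (1 + (ξ : ℂ) * k) * b k := hb.affine_mul 1 _
  refine ⟨⟨?_, ?_, ?_⟩, fun z hz hz0 => ?_⟩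
  · refine (((differentiableOn_id.mul hb.analyticOnNhd.differentiableOn).congr
      fun z hz => ?_).analyticOnNhd Metric.isOpen_ball)
    simpa using hF z hz
  · rw [hF 0 hmem0, zero_mul]
  · rw [hb.deriv_of_eqOn hF hmem0, pser_zero, hb0]
    simp
  · have hz' := mem_ball_zero_iff.1 hz
    obtain ⟨hne, hpos⟩ := starlike_of_pser_ne_zero hg h hz'
    have hd2 : deriv (fun w => w * deriv F w) z = pser (fun k => (1 + k) * ((1 + k) * b k)) z :=
      hb1.deriv_of_eqOn (fun w hw => by rw [hb.deriv_of_eqOn hF hw]) hz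
    have e1 := pser_affine_mul hb 1 1 hz'
    have e2 := pser_affine_mul hb.nat_mul 1 1 hz'
    have e3 := pser_affine_mul hb1 1 1 hz'
    simp only [one_mul] at e1 e2 e3
    have e4 : pser (fun k : ℕ => (k : ℂ) * ((1 + k) * b k)) z =
        pser (fun k : ℕ => (1 + (k : ℂ)) * (k * b k)) z := by
      congr 1; ext k; ring
    have e5 := pser_affine_mul hb 1 (ξ : ℂ) hz'
    have e6 := pser_affine_mul hb.nat_mul 1 (ξ : ℂ) hz'
    have e7 : pser (fun k : ℕ => (k : ℂ) * ((1 + ξ * k) * b k)) z =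
        pser (fun k : ℕ => (1 + ξ * (k : ℂ)) * (k * b k)) z := by
      congr 1; ext k; ring
    rw [one_mul] at e5 e6
    convert hpos using 2
    rw [hd2, hb.deriv_of_eqOn hF hz, hF z hz, e3, e4, e2, e1]
    rw [e5] at hne ⊢
    rw [e7, e6]
    have hden : ξ * (z * (pser b z + pser (fun k : ℕ => (k : ℂ) * b k) z)) +
        (1 - ξ) * (z * pser b z) =
        z * (pser b z + ξ * pser (fun k : ℕ => (k : ℂ) * b k) z) := by ring
    rw [hden, one_add_div hne, div_eq_div_iff (mul_ne_zero hz0 hne) hne]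
    ring

end Classes

end KomatuPascu

theorem mainTheorem8 (α β γ μ ν ξ c p : ℝ)
    (hγ : 0 < γ) (hμ : 1 ≤ μ)
    (hsum : μ + ν = α - γ) (hprod : μ * ν = γ)
    (hc1 : -1 < c) (hc0 : c < 0) (hp : 2 < p)
    (hξ0 : 0 ≤ ξ) (hξ1 : ξ ≤ 1) (hβ : β < 1)
    (q : ℝ → ℝ) (hq : KomatuPascu.SolvesQ μ ν q)
    (hβq : (β - 1 / 2) / (1 - β) =
      -((1 + c) ^ p / Real.Gamma p *
        ∫ t in (0 : ℝ)..1, t ^ c * Real.log (1 / t) ^ (p - 1) * q t))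
    (f : ℂ → ℂ) (hf : KomatuPascu.ClassW α β γ f) :
    KomatuPascu.ClassM ξ (KomatuPascu.komatu c p f) := by
  have hν : 0 < ν := pos_of_mul_pos_right (hprod ▸ hγ) (by linarith)
  obtain ⟨a, ha, ha0, hd, hfa⟩ := hf.1.exists_pser
  have hp0 : 0 < p := by linarith
  refine KomatuPascu.classM_of_pser (ha.komatuCoeff_mul hc1 hp0.le) ?_
    (fun z hz => KomatuPascu.komatu_eq_mul_pser hc1 hp0 ha hfa hz)
    fun v z hv hz => KomatuPascu.pser_pascu_ne_zero hμ hν hsum hprod hc1 hc0 hp hξ0 hξ1 hβ hq hβq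
      hf ha ha0 hd hfa hv hz
  have hc' : c + 1 ≠ 0 := by linarith
  simp [KomatuPascu.komatuCoeff, hc', ha0]
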